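/- **Definitions.** A (prime) event structure $(P,\le,\mathrm{Con})$ is a set $P$ partially ordered by $\le$, with each $\{p'\mid p'\le p\}$ finite, and a nonempty family $\mathrm{Con}$ of finite subsets of $P$ that contains all singletons, is closed under subsets, and satisfies $X\cup\{e\}\in\mathrm{Con}$ whenever $X\in\mathrm{Con}$ and $e\le e'\in X$. An *edc* (event structure with disjunctive causes) has in addition an equivalence relation $\equiv$ on $P$ such that $p_1,p_2\le p$ and $p_1\equiv p_2$ imply $p_1=p_2$. A configuration is a down-closed set of events all of whose finite subsets are consistent; $\mathcal C(P)$ is the set of finite ones; $x$ enables $e$ if $e\notin x$ and $x,x\cup\{e\}\in\mathcal C(P)$. A set is unambiguous if no two distinct elements of it are $\equiv$-equivalent. $[X]$ is the down-closure of $X$, $[s)$ the set of events strictly below $s$, and $\rightarrowtriangle$ is immediate dependency. In an edc with polarity every event has a polarity $+$ (Player) or $-$ (Opponent), respected by $\equiv$; $x\subseteq^{+}y$ (resp. $x\subseteq^{-}y$) means that $x\subseteq y$ and all events of $y\setminus x$ are $+$ (resp. $-$). $A^\perp$ reverses polarities; $A\parallel B$ is disjoint juxtaposition. A *game* is an edc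 with polarity whose $\equiv$ is equality; it is *race-free* if, whenever $x$ enables $a$ and $a'$ of opposite polarities, $x\cup\{a,a'\}$ is a configuration. A total map of edc's $f:P\to Q$ is a function which preserves $\equiv$ and for which, for all $x\in\mathcal C(P)$, $fx\in\mathcal C(Q)$ and $f(p)\equiv f(q)$ implies $p\equiv q$ for $p,q\in x$. A *pre-strategy* in a game $A$ is a polarity-preserving total map $\sigma:S\to A$ from an edc with polarity $S$. It is an *edc strategy* if it satisfies * innocence: $s\rightarrowtriangle s'$ with $\mathrm{pol}(s)=+$ or $\mathrm{pol}(s')=-$ implies $\sigma(s)\rightarrowtriangle\sigma(s')$; * $\exists$-receptivity: if $x\in\mathcal C(S)$ and $\sigma x$ enables $a$ with $\mathrm{pol}(a)=-$, then $x$ enables some $s$ with $\sigma(s)=a$; * $+$-consistency: if $X\subseteq S$ is finite, $\sigma[X]\in\mathrm{Con}_A$ and the set $[X]^+$ of $+$ events of $[X]$ is in $\mathrm{Con}_S$, then $X\in\mathrm{Con}_S$; * non-redundancy: $s_1=s_2$ if $[s_1)=[s_2)$, $s_1\equiv s_2$ and both have polarity $-$; * $\equiv$-saturation: $\sigma(s_1)=\sigma(s_2)$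 implies $s_1\equiv s_2$. A *configuration-valuation* on $S$ is a function $v:\mathcal C(S)\to[0,1]$ with $v(\emptyset)=1$; $v(x)=v(y)$ whenever $x\subseteq^{-}y$; and, whenever $y\subseteq^{+}x_1,\dots,x_n$, $$v(y)-\sum_I(-1)^{|I|+1}v\Big(\bigcup_{i\in I}x_i\Big)\ \ge\ 0,$$ where $I$ ranges over the nonempty $I\subseteq\{1,\dots,n\}$ for which $\bigcup_{i\in I}x_i$ is a configuration. A *probabilistic edc strategy* is an edc strategy $\sigma:S\to A$ in a race-free game together with a configuration-valuation on $S$; one from $A$ to $B$ is one in $A^\perp\parallel B$. *Composition.* Let $\sigma:S\to A^\perp\parallel B$ and $\tau:T\to B^\perp\parallel C$ be pre-strategies. Let $D$ be the set of pairs $d=(\pi_1d,\pi_2d)$ of an event of $S\parallel C$ and an event of $A\parallel T$ that have the same image in $A\parallel B\parallel C$ under $\sigma\parallel C$ and $A\parallel\tau$; put $d\equiv d'$ if $\pi_1d\equiv\pi_1d'$ and $\pi_2d\equiv\pi_2d'$. Call $x\subseteq D$ matching if $\pi_1x$ and $\pi_2x$ are configurations, and secured if moreover every $d\in x$ is the last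 term of a finite sequence in $x$ all of whose initial segments are matching. Let $\mathcal F$ be the family of secured sets that are unions of unambiguous secured sets. The pullback edc $T\circledast S$ has as events the prime configurations, i.e. the unambiguous $p\in\mathcal F$ with a (unique) top event $d\in p$ such that $d\in y\subseteq p$ with $y\in\mathcal F$ implies $y=p$; these are ordered by inclusion, equivalent when their tops are, and a finite set $Z$ of them is consistent when $\bigcup Z\in\mathcal F$. The composite $T\odot S$ is the restriction of $T\circledast S$ to the events lying over $A$ or $C$, and $\tau\odot\sigma:T\odot S\to A^\perp\parallel C$ sends an event to the image of its top, from which polarities are taken. For $x\in\mathcal C(T\odot S)$ let $[x]$ be its down-closure in $T\circledast S$; let $\pi_1^Sx\in\mathcal C(S)$ be the $S$-component of the set of the $\pi_1$-projections of the tops of the events in $[x]$, and $\pi_2^Tx\in\mathcal C(T)$ the $T$-component of the set of their $\pi_2$-projections. **Theorem.** Let $A,B,C$ be race-free games, let $\sigma:S\to A^\perp\parallel B$ with $v_S$ and $\tau:T\to B^\perp\parallel C$ with $v_T$ be probabilistic edc strategies. Then $T\odot S$ is an edc with polarity, $\tau\odot\sigma$ is a pre-strategy in $A^\perp\parallel C$,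 and $$v(x)=v_S(\pi_1^Sx)\cdot v_T(\pi_2^Tx)\qquad(x\in\mathcal C(T\odot S))$$ defines a configuration-valuation on $T\odot S$. Moreover $\tau\odot\sigma$ is innocent, $+$-consistent, non-redundant and $\equiv$-saturated. -/

import Mathlib

/-! # Event structures with disjunctive causes (edc's), edc strategies, and their composition -/

/-- Polarities of moves: `plus` for Player, `minus` for Opponent. -/
inductive Polarity where
  | plus : Polarity
  | minus : Polarity

/-- Reversal of polarity. -/
def Polarity.flip : Polarity → Polarity
  | .plus => .minus
  | .minus => .plus

/-! ## Prime event structures -/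

/-- A prime event structure on the set of events `E`. -/
structure EventStructure (E : Type*) where
  /-- causal dependency -/
  le : E → E → Prop
  le_refl : ∀ e, le e e
  le_trans : ∀ {a b c}, le a b → le b c → le a c
  le_antisymm : ∀ {a b}, le a b → le b a → a = b
  /-- the consistency relation, a collection of finite sets of events -/
  Con : Set (Set E)
  con_finite : ∀ {X}, X ∈ Con → X.Finite
  con_empty : ∅ ∈ Con
  finite_below : ∀ e, {e' | le e' e}.Finite
  con_singleton : ∀ e, {e} ∈ Con
  con_mono : ∀ {X Y}, Y ⊆ X → X ∈ Con → Y ∈ Con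
  con_insert : ∀ {X e e'}, X ∈ Con → le e e' → e' ∈ X → insert e X ∈ Con

namespace EventStructure

variable {E : Type*} (P : EventStructure E)

/-- The down-closure `[X]` of a set of events. -/
def down (X : Set E) : Set E := {e | ∃ e' ∈ X, P.le e e'}

/-- The set `[e)` of events strictly below `e`. -/
def strictBelow (e : E) : Set E := {e' | P.le e' e ∧ e' ≠ e}

/-- Immediate causal dependency. -/
def Imm (e e' : E) : Prop :=
  P.le e e' ∧ e ≠ e' ∧ ∀ d, P.le e d → P.le d e' → d = e ∨ d = e'

/-- Configurations, possibly infinite: consistent, down-closed sets of events. -/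
def IsConfig (x : Set E) : Prop :=
  (∀ X, X ⊆ x → X.Finite → X ∈ P.Con) ∧ ∀ e ∈ x, ∀ e', P.le e' e → e' ∈ x

/-- Finite configurations. -/
def IsFinConfig (x : Set E) : Prop := P.IsConfig x ∧ x.Finite

/-- The event `e` is enabled at the finite configuration `x`. -/
def Enabled (x : Set E) (e : E) : Prop :=
  P.IsFinConfig x ∧ e ∉ x ∧ P.IsFinConfig (insert e x)

end EventStructure

/-! ## Event structures with disjunctive causes -/

/-- An event structure with disjunctive causes (edc) on the set of events `E`. -/
structure Edc (E : Type*) extends EventStructure E where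
  equiv : E → E → Prop
  equiv_equivalence : Equivalence equiv
  disj : ∀ {p₁ p₂ p}, le p₁ p → le p₂ p → equiv p₁ p₂ → p₁ = p₂

/-- An edc with polarity. -/
structure EdcPol (E : Type*) extends Edc E where
  pol : E → Polarity
  pol_equiv : ∀ {p q}, equiv p q → pol p = pol q

/-- A total map of edc's. -/
structure EdcMap {E F : Type*} (P : Edc E) (Q : Edc F) where
  toFun : E → F
  map_equiv : ∀ {p q}, P.equiv p q → Q.equiv (toFun p) (toFun q)
  map_config : ∀ {x}, P.IsFinConfig x → Q.IsFinConfig (toFun '' x)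
  locally_inj : ∀ {x}, P.IsFinConfig x → ∀ p ∈ x, ∀ q ∈ x,
    Q.equiv (toFun p) (toFun q) → P.equiv p q

theorem EventStructure.isFinConfig_down_pair {E : Type*} (P : EventStructure E) {x : Set E}
    (hx : P.IsConfig x) {p q : E} (hp : p ∈ x) (hq : q ∈ x) :
    P.IsFinConfig (P.down {p, q}) := by
  have hsub : P.down {p, q} ⊆ x := by
    rintro e ⟨e', he', h⟩
    rcases he' with rfl | rfl
    · exact hx.2 _ hp _ h
    · exact hx.2 _ hq _ h
  refine ⟨⟨fun X hX hf => hx.1 X (hX.trans hsub) hf, ?_⟩, ?_⟩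
  · rintro e ⟨e', he', h⟩ d hd
    exact ⟨e', he', P.le_trans hd h⟩
  · refine ((P.finite_below p).union (P.finite_below q)).subset ?_
    rintro e ⟨e', he', h⟩
    rcases he' with rfl | rfl
    · exact Or.inl h
    · exact Or.inr h

theorem EdcMap.locally_inj' {E F : Type*} {P : Edc E} {Q : Edc F} (f : EdcMap P Q) {x : Set E}
    (hx : P.IsConfig x) {p q : E} (hp : p ∈ x) (hq : q ∈ x)
    (h : Q.equiv (f.toFun p) (f.toFun q)) : P.equiv p q :=
  f.locally_inj (P.isFinConfig_down_pair hx hp hq)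
    p ⟨p, Or.inl rfl, P.le_refl p⟩ q ⟨q, Or.inr rfl, P.le_refl q⟩ h

/-! ## Simple parallel composition and dual -/

/-- The simple parallel composition of edc's: juxtaposition. -/
def Edc.par {E F : Type*} (P : Edc E) (Q : Edc F) : Edc (E ⊕ F) where
  le := Sum.LiftRel P.le Q.le
  le_refl e := by
    cases e
    · exact .inl (P.le_refl _)
    · exact .inr (Q.le_refl _)
  le_trans h₁ h₂ := by
    cases h₁ with
    | inl h => cases h₂ with | inl h' => exact .inl (P.le_trans h h')
    | inr h => cases h₂ with | inr h' => exact .inr (Q.le_trans h h')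
  le_antisymm h₁ h₂ := by
    cases h₁ with
    | inl h => cases h₂ with | inl h' => exact congrArg _ (P.le_antisymm h h')
    | inr h => cases h₂ with | inr h' => exact congrArg _ (Q.le_antisymm h h')
  Con := {X | Sum.inl ⁻¹' X ∈ P.Con ∧ Sum.inr ⁻¹' X ∈ Q.Con}
  con_finite {X} h := by
    have := ((P.con_finite h.1).image Sum.inl).union ((Q.con_finite h.2).image Sum.inr)
    refine this.subset ?_
    rintro (e | e) he
    · exact Or.inl ⟨e, he, rfl⟩
    · exact Or.inr ⟨e, he, rfl⟩
  con_empty := ⟨P.con_empty, Q.con_empty⟩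
  finite_below e := by
    cases e with
    | inl e =>
      refine ((P.finite_below e).image Sum.inl).subset ?_
      rintro d hd
      cases hd with | inl h => exact ⟨_, h, rfl⟩
    | inr e =>
      refine ((Q.finite_below e).image Sum.inr).subset ?_
      rintro d hd
      cases hd with | inr h => exact ⟨_, h, rfl⟩
  con_singleton e := by
    cases e with
    | inl e =>
      exact ⟨P.con_mono (fun d hd => Sum.inl_injective hd) (P.con_singleton e),
        Q.con_mono (fun d hd => nomatch hd) Q.con_empty⟩
    | inr e =>
      exact ⟨P.con_mono (fun d hd => nomatch hd) P.con_empty,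
        Q.con_mono (fun d hd => Sum.inr_injective hd) (Q.con_singleton e)⟩
  con_mono h hX := ⟨P.con_mono (Set.preimage_mono h) hX.1, Q.con_mono (Set.preimage_mono h) hX.2⟩
  con_insert {X e e'} hX h he := by
    cases h with
    | inl h =>
      refine ⟨P.con_mono ?_ (P.con_insert hX.1 h he), Q.con_mono ?_ hX.2⟩
      · rintro d (hd | hd)
        · exact Or.inl (Sum.inl_injective hd)
        · exact Or.inr hd
      · rintro d (hd | hd)
        · cases hd
        · exact hd
    | inr h =>
      refine ⟨P.con_mono ?_ hX.1, Q.con_mono ?_ (Q.con_insert hX.2 h he)⟩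
      · rintro d (hd | hd)
        · cases hd
        · exact hd
      · rintro d (hd | hd)
        · exact Or.inl (Sum.inr_injective hd)
        · exact Or.inr hd
  equiv := Sum.LiftRel P.equiv Q.equiv
  equiv_equivalence := by
    refine ⟨?_, ?_, ?_⟩
    · rintro (e | e)
      · exact .inl (P.equiv_equivalence.refl e)
      · exact .inr (Q.equiv_equivalence.refl e)
    · rintro _ _ (h | h)
      · exact .inl (P.equiv_equivalence.symm h)
      · exact .inr (Q.equiv_equivalence.symm h)
    · rintro _ _ _ (h | h) h₂
      · cases h₂ with | inl h' => exact .inl (P.equiv_equivalence.trans h h')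
      · cases h₂ with | inr h' => exact .inr (Q.equiv_equivalence.trans h h')
  disj h₁ h₂ h := by
    cases h with
    | inl h => cases h₁ with | inl h₁ => cases h₂ with | inl h₂ => exact congrArg _ (P.disj h₁ h₂ h)
    | inr h => cases h₁ with | inr h₁ => cases h₂ with | inr h₂ => exact congrArg _ (Q.disj h₁ h₂ h)

/-- The simple parallel composition of edc's with polarity. -/
def EdcPol.par {E F : Type*} (P : EdcPol E) (Q : EdcPol F) : EdcPol (E ⊕ F) where
  toEdc := P.toEdc.par Q.toEdc
  pol := Sum.elim P.pol Q.pol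
  pol_equiv h := by
    cases h with
    | inl h => exact P.pol_equiv h
    | inr h => exact Q.pol_equiv h

/-- The dual of an edc with polarity: reversal of polarities. -/
def EdcPol.dual {E : Type*} (P : EdcPol E) : EdcPol E where
  toEdc := P.toEdc
  pol e := (P.pol e).flip
  pol_equiv h := congrArg _ (P.pol_equiv h)

namespace EdcPol

variable {E : Type*} (P : EdcPol E)

/-- A game is an edc with polarity that is a prime event structure, i.e. whose
equivalence is equality. -/
def IsGame : Prop := ∀ a b, P.equiv a b → a = b

/-- Race-freeness. -/
def RaceFree : Prop :=
  ∀ x a a', P.Enabled x a → P.Enabled x a' → P.pol a ≠ P.pol a' →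
    P.IsFinConfig (x ∪ {a, a'})

/-- Non-redundancy. -/
def NonRedundant : Prop :=
  ∀ s₁ s₂, P.strictBelow s₁ = P.strictBelow s₂ → P.equiv s₁ s₂ →
    P.pol s₁ = .minus → P.pol s₂ = .minus → s₁ = s₂

/-- `x ⊆⁺ y`: every additional event is a Player move. -/
def SubPlus (x y : Set E) : Prop := x ⊆ y ∧ ∀ e ∈ y, e ∉ x → P.pol e = .plus

/-- `x ⊆⁻ y`: every additional event is an Opponent move. -/
def SubMinus (x y : Set E) : Prop := x ⊆ y ∧ ∀ e ∈ y, e ∉ x → P.pol e = .minus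

open Classical in
/-- The drop of `v` across the generalised interval from `y` to `x 0, …, x (n - 1)`:
`v y` minus the sum of `(-1) ^ (|I| + 1) * v (⋃ i ∈ I, x i)` over the nonempty sets `I` of indices
for which the union is a configuration. -/
noncomputable def drop (v : Set E → ℝ) (y : Set E) {n : ℕ} (x : Fin n → Set E) : ℝ :=
  v y - ∑ I ∈ (Finset.univ : Finset (Finset (Fin n))) with
      (I.Nonempty ∧ P.IsFinConfig (⋃ i ∈ I, x i)),
    (-1 : ℝ) ^ (I.card + 1) * v (⋃ i ∈ I, x i)

/-- Configuration-valuations on an edc with polarity. Only the values of `v` at finite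
configurations matter. -/
structure IsConfigValuation (v : Set E → ℝ) : Prop where
  mem_unit : ∀ x, P.IsFinConfig x → 0 ≤ v x ∧ v x ≤ 1
  normalized : v ∅ = 1
  lmc : ∀ x y, P.IsFinConfig x → P.IsFinConfig y → P.SubMinus x y → v x = v y
  drop_nonneg : ∀ (y : Set E) (n : ℕ) (x : Fin n → Set E), P.IsFinConfig y →
    (∀ i, P.IsFinConfig (x i)) → (∀ i, P.SubPlus y (x i)) → 0 ≤ P.drop v y x

end EdcPol

/-! ## Edc strategies -/

/-- An edc pre-strategy in `A`: a total map of edc's with polarity from `S` to `A`. -/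
structure PreStrategy {E F : Type*} (S : EdcPol E) (A : EdcPol F) extends
    EdcMap S.toEdc A.toEdc where
  map_pol : ∀ s, A.pol (toFun s) = S.pol s

namespace PreStrategy

variable {E F : Type*} {S : EdcPol E} {A : EdcPol F} (σ : PreStrategy S A)

/-- Innocence. -/
def Innocent : Prop :=
  ∀ s s', S.Imm s s' → (S.pol s = .plus ∨ S.pol s' = .minus) → A.Imm (σ.toFun s) (σ.toFun s')

/-- `∃`-receptivity. -/
def ExistsReceptive : Prop :=
  ∀ x a, S.IsFinConfig x → A.Enabled (σ.toFun '' x) a → A.pol a = .minus →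
    ∃ s, S.Enabled x s ∧ σ.toFun s = a

/-- `+`-consistency: a finite set of events is consistent if the image of its down-closure and the
set of Player moves in its down-closure are. -/
def PlusConsistent : Prop :=
  ∀ X : Set E, X.Finite → σ.toFun '' S.down X ∈ A.Con →
    {s ∈ S.down X | S.pol s = .plus} ∈ S.Con → X ∈ S.Con

/-- `≡`-saturation. -/
def Saturated : Prop := ∀ s₁ s₂, σ.toFun s₁ = σ.toFun s₂ → S.equiv s₁ s₂

/-- Edc strategies. -/
structure IsStrategy : Prop where
  innocent : σ.Innocent
  existsReceptive : σ.ExistsReceptive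
  plusConsistent : σ.PlusConsistent
  nonRedundant : S.NonRedundant
  saturated : σ.Saturated

/-- Probabilistic edc strategies: an edc strategy with a configuration-valuation. -/
structure IsProbStrategy (v : Set E → ℝ) : Prop where
  isStrategy : σ.IsStrategy
  isConfigValuation : S.IsConfigValuation v

end PreStrategy

/-! ## Stable equivalence families and the edc of their prime configurations -/

/-- A set of events is unambiguous if no two distinct members are equivalent. -/
def Unambiguous {D : Type*} (r : D → D → Prop) (x : Set D) : Prop :=
  ∀ a ∈ x, ∀ b ∈ x, r a b → a = b

/-- A stable equivalence family: a family of configurations, closed under finitely compatible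
unions and with securing chains, together with an equivalence for which it is stable. -/
structure StableFamily (D : Type*) where
  F : Set (Set D)
  equiv : D → D → Prop
  equiv_equivalence : Equivalence equiv
  empty_mem : ∅ ∈ F
  sUnion_mem : ∀ X ⊆ F, (∀ Y ⊆ X, Y.Finite → ∃ z ∈ F, ∀ y ∈ Y, y ⊆ z) → ⋃₀ X ∈ F
  secured : ∀ x ∈ F, ∀ d ∈ x, ∃ l : List D, (∀ e ∈ l, e ∈ x) ∧
    ∀ l', l' <+: l ++ [d] → {e | e ∈ l'} ∈ F
  inter_mem : ∀ x ∈ F, ∀ y ∈ F, ∀ z ∈ F, x ⊆ z → y ⊆ z → Unambiguous equiv z → x ∩ y ∈ F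
  exists_unambiguous : ∀ x ∈ F, ∀ d ∈ x, ∃ z ∈ F, Unambiguous equiv z ∧ d ∈ z ∧ z ⊆ x

namespace StableFamily

variable {D : Type*} (𝓕 : StableFamily D)

/-- A prime configuration together with its top event: an unambiguous configuration which is the
least one, among those it includes, to contain that event. -/
structure Prime where
  carrier : Set D
  top : D
  mem : carrier ∈ 𝓕.F
  unambiguous : Unambiguous 𝓕.equiv carrier
  top_mem : top ∈ carrier
  least : ∀ y ∈ 𝓕.F, top ∈ y → y ⊆ carrier → y = carrier

variable {𝓕}

theorem Prime.finite (p : 𝓕.Prime) : p.carrier.Finite := by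
  obtain ⟨l, hl, hp⟩ := 𝓕.secured _ p.mem _ p.top_mem
  have h := p.least _ (hp (l ++ [p.top]) (List.prefix_refl _)) (by simp) (by
    intro e he
    rcases List.mem_append.1 he with he | he
    · exact hl e he
    · rw [List.mem_singleton.1 he]; exact p.top_mem)
  rw [← h]
  exact List.finite_toSet _

theorem Prime.top_eq {p q : 𝓕.Prime} (h : p.carrier = q.carrier) : p.top = q.top := by
  obtain ⟨l, hl, hp⟩ := 𝓕.secured _ p.mem _ p.top_mem
  have hsub : ∀ e ∈ l ++ [p.top], e ∈ p.carrier := by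
    intro e he
    rcases List.mem_append.1 he with he | he
    · exact hl e he
    · rw [List.mem_singleton.1 he]; exact p.top_mem
  by_contra hne
  by_cases hq : q.top ∈ l
  · obtain ⟨l₁, l₂, rfl, hnot⟩ := List.eq_append_cons_of_mem hq
    by_cases hpt : p.top ∈ l₁
    · have h1 := p.least _ (hp l₁ ⟨q.top :: l₂ ++ [p.top], by simp⟩) hpt
        (fun e he => hsub e (by simp at he ⊢; tauto))
      have : q.top ∈ {e | e ∈ l₁} := by rw [h1, h]; exact q.top_mem
      exact hnot this
    · have h1 := q.least _ (hp (l₁ ++ [q.top]) ⟨l₂ ++ [p.top], by simp⟩) (by simp)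
        (fun e he => h ▸ hsub e (by simp at he ⊢; tauto))
      have : p.top ∈ {e | e ∈ l₁ ++ [q.top]} := by rw [h1, ← h]; exact p.top_mem
      simp only [Set.mem_ofPred_eq, List.mem_append, List.mem_singleton] at this
      tauto
  · have hq' : q.top ∈ {e | e ∈ l ++ [p.top]} := by
      rw [p.least _ (hp (l ++ [p.top]) (List.prefix_refl _)) (by simp) hsub, h]
      exact q.top_mem
    simp only [Set.mem_ofPred_eq, List.mem_append, List.mem_singleton] at hq'
    rcases hq' with h' | h'
    · exact hq h'
    · exact hne h'.symm

theorem Prime.ext' {p q : 𝓕.Prime} (h : p.carrier = q.carrier) : p = q := by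
  have ht := Prime.top_eq h
  cases p; cases q
  simp only at h ht
  subst h; subst ht; rfl

variable (𝓕)

/-- The edc of prime configurations of a stable equivalence family. -/
def primes : Edc 𝓕.Prime where
  le p q := p.carrier ⊆ q.carrier
  le_refl p := subset_rfl
  le_trans h₁ h₂ := h₁.trans h₂
  le_antisymm h₁ h₂ := Prime.ext' (h₁.antisymm h₂)
  Con := {Z | Z.Finite ∧ ⋃ p ∈ Z, p.carrier ∈ 𝓕.F}
  con_finite h := h.1
  con_empty := ⟨Set.finite_empty, by simpa using 𝓕.empty_mem⟩
  finite_below p := by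
    refine Set.Finite.of_finite_image (f := Prime.carrier) (p.finite.finite_subsets.subset ?_) ?_
    · rintro _ ⟨q, hq, rfl⟩
      exact hq
    · intro q _ q' _ h
      exact Prime.ext' h
  con_singleton p := ⟨Set.finite_singleton p, by simpa using p.mem⟩
  con_mono {X Y} h hX := by
    refine ⟨hX.1.subset h, ?_⟩
    rw [← Set.sUnion_image]
    refine 𝓕.sUnion_mem _ ?_ ?_
    · rintro _ ⟨p, _, rfl⟩
      exact p.mem
    · intro Y' hY' _
      refine ⟨_, hX.2, ?_⟩
      intro y hy
      obtain ⟨p, hp, rfl⟩ := hY' hy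
      exact Set.subset_biUnion_of_mem (u := fun p : 𝓕.Prime => p.carrier) (h hp)
  con_insert {X e e'} hX h he := by
    refine ⟨hX.1.insert e, ?_⟩
    have : ⋃ p ∈ insert e X, p.carrier = ⋃ p ∈ X, p.carrier := by
      rw [Set.biUnion_insert]
      exact Set.union_eq_right.2
        (h.trans (Set.subset_biUnion_of_mem (u := fun p : 𝓕.Prime => p.carrier) he))
    rw [this]
    exact hX.2
  equiv p q := 𝓕.equiv p.top q.top
  equiv_equivalence := ⟨fun _ => 𝓕.equiv_equivalence.refl _,
    fun h => 𝓕.equiv_equivalence.symm h, fun h h' => 𝓕.equiv_equivalence.trans h h'⟩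
  disj {p₁ p₂ p} h₁ h₂ h := by
    have ht : p₁.top = p₂.top := p.unambiguous _ (h₁ p₁.top_mem) _ (h₂ p₂.top_mem) h
    have hm := 𝓕.inter_mem _ p₁.mem _ p₂.mem _ p.mem h₁ h₂ p.unambiguous
    have e₁ := p₁.least _ hm ⟨p₁.top_mem, ht ▸ p₂.top_mem⟩ Set.inter_subset_left
    have e₂ := p₂.least _ hm ⟨ht ▸ p₁.top_mem, p₂.top_mem⟩ Set.inter_subset_right
    exact Prime.ext' (e₁.symm.trans e₂)

end StableFamily

/-! ## Pullback of edc's -/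

theorem EventStructure.isConfig_image_sUnion {D E : Type*} (P : EventStructure E) (φ : D → E)
    (X : Set (Set D)) (hX : ∀ y ∈ X, P.IsConfig (φ '' y))
    (hc : ∀ Y ⊆ X, Y.Finite → ∃ z, P.IsConfig (φ '' z) ∧ ∀ y ∈ Y, y ⊆ z) :
    P.IsConfig (φ '' ⋃₀ X) := by
  constructor
  · intro W hW hf
    have h : ∀ w : W, ∃ y ∈ X, (w : E) ∈ φ '' y := by
      rintro ⟨w, hw⟩
      obtain ⟨d, ⟨y, hy, hd⟩, rfl⟩ := hW hw
      exact ⟨y, hy, d, hd, rfl⟩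
    choose k hk hk' using h
    have := hf.to_subtype
    obtain ⟨z, hz, hz'⟩ := hc (Set.range k) (by rintro _ ⟨w, rfl⟩; exact hk w) (Set.finite_range k)
    exact hz.1 W (fun w hw => Set.image_mono (hz' _ ⟨⟨w, hw⟩, rfl⟩) (hk' ⟨w, hw⟩)) hf
  · rintro _ ⟨d, ⟨y, hy, hd⟩, rfl⟩ e he
    obtain ⟨d', hd', rfl⟩ := (hX y hy).2 _ ⟨d, hd, rfl⟩ e he
    exact ⟨d', ⟨y, hy, hd'⟩, rfl⟩

theorem EventStructure.isConfig_image_inter {D E : Type*} (P : EventStructure E) (φ : D → E)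
    {x y z : Set D} (hz : Set.InjOn φ z) (hxz : x ⊆ z) (hyz : y ⊆ z)
    (hx : P.IsConfig (φ '' x)) (hy : P.IsConfig (φ '' y)) : P.IsConfig (φ '' (x ∩ y)) := by
  rw [hz.image_inter hxz hyz]
  exact ⟨fun W hW hf => hx.1 W (hW.trans Set.inter_subset_left) hf,
    fun e he e' h => ⟨hx.2 e he.1 e' h, hy.2 e he.2 e' h⟩⟩

section Pullback

variable {E F G : Type*} {P : Edc E} {Q : Edc F} {R : Edc G} (f : EdcMap P R) (g : EdcMap Q R)

/-- Pairs of events with the same image. -/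
def PbEvent : Type _ := {d : E × F // f.toFun d.1 = g.toFun d.2}

variable {f g}

/-- Left projection. -/
def PbEvent.fst (d : PbEvent f g) : E := d.1.1

/-- Right projection. -/
def PbEvent.snd (d : PbEvent f g) : F := d.1.2

theorem PbEvent.comm (d : PbEvent f g) : f.toFun d.fst = g.toFun d.snd := d.2

theorem PbEvent.ext' {d d' : PbEvent f g} (h : d.fst = d'.fst) (h' : d.snd = d'.snd) : d = d' :=
  Subtype.ext (Prod.ext h h')

/-- Both projections of `x` are configurations. -/
def PbMatching (x : Set (PbEvent f g)) : Prop :=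
  P.IsConfig (PbEvent.fst '' x) ∧ Q.IsConfig (PbEvent.snd '' x)

/-- Configurations of the pullback in equivalence families. -/
def PbConfig (x : Set (PbEvent f g)) : Prop :=
  PbMatching x ∧ ∀ d ∈ x, ∃ l : List (PbEvent f g), (∀ e ∈ l, e ∈ x) ∧
    ∀ l', l' <+: l ++ [d] → PbMatching {e | e ∈ l'}

/-- Events of the pullback are equivalent when both their projections are. -/
def PbEquiv (d d' : PbEvent f g) : Prop := P.equiv d.fst d'.fst ∧ Q.equiv d.snd d'.snd

/-- Configurations of the pullback in stable equivalence families: those configurations of the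
pullback in equivalence families which are unions of unambiguous ones. -/
def PbStableConfig (x : Set (PbEvent f g)) : Prop :=
  PbConfig x ∧ ∀ d ∈ x, ∃ z, PbConfig z ∧ Unambiguous PbEquiv z ∧ d ∈ z ∧ z ⊆ x

theorem PbMatching.injOn_fst {z : Set (PbEvent f g)} (hz : PbMatching z)
    (hu : Unambiguous PbEquiv z) : Set.InjOn PbEvent.fst z := by
  intro d hd d' hd' h
  refine hu d hd d' hd' ⟨h ▸ P.equiv_equivalence.refl _, ?_⟩
  refine g.locally_inj' hz.2 ⟨d, hd, rfl⟩ ⟨d', hd', rfl⟩ ?_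
  rw [← d.comm, ← d'.comm, h]
  exact R.equiv_equivalence.refl _

theorem PbMatching.injOn_snd {z : Set (PbEvent f g)} (hz : PbMatching z)
    (hu : Unambiguous PbEquiv z) : Set.InjOn PbEvent.snd z := by
  intro d hd d' hd' h
  refine hu d hd d' hd' ⟨?_, h ▸ Q.equiv_equivalence.refl _⟩
  refine f.locally_inj' hz.1 ⟨d, hd, rfl⟩ ⟨d', hd', rfl⟩ ?_
  rw [d.comm, d'.comm, h]
  exact R.equiv_equivalence.refl _

theorem PbMatching.inter {x y z : Set (PbEvent f g)} (hz : PbMatching z)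
    (hu : Unambiguous PbEquiv z) (hxz : x ⊆ z) (hyz : y ⊆ z)
    (hx : PbMatching x) (hy : PbMatching y) : PbMatching (x ∩ y) :=
  ⟨P.isConfig_image_inter _ (hz.injOn_fst hu) hxz hyz hx.1 hy.1,
    Q.isConfig_image_inter _ (hz.injOn_snd hu) hxz hyz hx.2 hy.2⟩

theorem Unambiguous.mono {D : Type*} {r : D → D → Prop} {x y : Set D} (h : x ⊆ y)
    (hy : Unambiguous r y) : Unambiguous r x := fun a ha b hb => hy a (h ha) b (h hb)

theorem PbConfig.stable {z : Set (PbEvent f g)} (hz : PbConfig z) (hu : Unambiguous PbEquiv z) :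
    PbStableConfig z := ⟨hz, fun _ hd => ⟨z, hz, hu, hd, subset_rfl⟩⟩

theorem PbConfig.of_list {l : List (PbEvent f g)}
    (h : ∀ l', l' <+: l → PbMatching {e | e ∈ l'}) : PbConfig {e | e ∈ l} := by
  refine ⟨h l (List.prefix_refl _), fun d hd => ?_⟩
  obtain ⟨l₁, l₂, hl, -⟩ := List.eq_append_cons_of_mem (show d ∈ l from hd)
  refine ⟨l₁, fun e he => ?_, fun l' hl' => h l' (hl'.trans ⟨l₂, by simp [hl]⟩)⟩
  show e ∈ l
  rw [hl]
  exact List.mem_append_left _ he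

theorem PbConfig.inter {x y z : Set (PbEvent f g)} (hz : PbConfig z)
    (hu : Unambiguous PbEquiv z) (hxz : x ⊆ z) (hyz : y ⊆ z)
    (hx : PbConfig x) (hy : PbConfig y) : PbConfig (x ∩ y) := by
  classical
  refine ⟨hz.1.inter hu hxz hyz hx.1 hy.1, fun d hd => ?_⟩
  obtain ⟨l, hl, hp⟩ := hx.2 d hd.1
  refine ⟨l.filter (· ∈ y), fun e he => ?_, fun l' hl' => ?_⟩
  · have := List.mem_filter.1 he
    exact ⟨hl e this.1, by simpa using this.2⟩
  · have hf : l.filter (· ∈ y) ++ [d] = (l ++ [d]).filter (· ∈ y) := by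
      simp [List.filter_append, hd.2]
    rw [hf, List.prefix_filter_iff] at hl'
    obtain ⟨m, hm, rfl⟩ := hl'
    have hs : {e | e ∈ m.filter (· ∈ y)} = {e | e ∈ m} ∩ y := by
      ext e; simp [List.mem_filter]
    rw [hs]
    refine hz.1.inter hu ?_ hyz (hp m hm) hy.1
    intro e he
    rcases List.mem_append.1 (hm.subset he) with h | h
    · exact hxz (hl e h)
    · rw [List.mem_singleton.1 h]; exact hxz hd.1

theorem isConfig_empty {E : Type*} (P : EventStructure E) : P.IsConfig ∅ :=
  ⟨fun X hX _ => by rw [Set.subset_empty_iff.1 hX]; exact P.con_empty, fun _ h => h.elim⟩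

variable (f g)

/-- The pullback of total maps of edc's, formed in stable equivalence families. -/
def pbFamily : StableFamily (PbEvent f g) where
  F := {x | PbStableConfig x}
  equiv := PbEquiv
  equiv_equivalence :=
    ⟨fun _ => ⟨P.equiv_equivalence.refl _, Q.equiv_equivalence.refl _⟩,
      fun h => ⟨P.equiv_equivalence.symm h.1, Q.equiv_equivalence.symm h.2⟩,
      fun h h' => ⟨P.equiv_equivalence.trans h.1 h'.1, Q.equiv_equivalence.trans h.2 h'.2⟩⟩
  empty_mem := by
    refine ⟨⟨⟨?_, ?_⟩, fun _ h => h.elim⟩, fun _ h => h.elim⟩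
    · rw [Set.image_empty]; exact isConfig_empty _
    · rw [Set.image_empty]; exact isConfig_empty _
  sUnion_mem X hX hc := by
    refine ⟨⟨⟨?_, ?_⟩, ?_⟩, ?_⟩
    · refine P.isConfig_image_sUnion _ X (fun y hy => (hX hy).1.1.1) fun Y hY hf => ?_
      obtain ⟨z, hz, h⟩ := hc Y hY hf
      exact ⟨z, hz.1.1.1, h⟩
    · refine Q.isConfig_image_sUnion _ X (fun y hy => (hX hy).1.1.2) fun Y hY hf => ?_
      obtain ⟨z, hz, h⟩ := hc Y hY hf
      exact ⟨z, hz.1.1.2, h⟩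
    · rintro d ⟨y, hy, hd⟩
      obtain ⟨l, hl, hp⟩ := (hX hy).1.2 d hd
      exact ⟨l, fun e he => ⟨y, hy, hl e he⟩, hp⟩
    · rintro d ⟨y, hy, hd⟩
      obtain ⟨z, hz, hu, hdz, hzy⟩ := (hX hy).2 d hd
      exact ⟨z, hz, hu, hdz, hzy.trans (Set.subset_sUnion_of_mem hy)⟩
  secured x hx d hd := by
    obtain ⟨z, hz, hu, hdz, hzx⟩ := hx.2 d hd
    obtain ⟨l, hl, hp⟩ := hz.2 d hdz
    refine ⟨l, fun e he => hzx (hl e he), fun l' hl' => ?_⟩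
    refine PbConfig.stable (.of_list fun m hm => hp m (hm.trans hl')) (hu.mono fun e he => ?_)
    rcases List.mem_append.1 (hl'.subset he) with h | h
    · exact hl e h
    · rw [List.mem_singleton.1 h]; exact hdz
  inter_mem x hx y hy z hz hxz hyz hu :=
    (hz.1.inter hu hxz hyz hx.1 hy.1).stable (hu.mono (Set.inter_subset_left.trans hxz))
  exists_unambiguous x hx d hd := by
    obtain ⟨z, hz, hu, hdz, hzx⟩ := hx.2 d hd
    exact ⟨z, hz.stable hu, hu, hdz, hzx⟩

/-- The pullback in edc's of total maps of edc's. -/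
def Edc.pullback : Edc (pbFamily f g).Prime := (pbFamily f g).primes

end Pullback

/-! ## Hiding -/

/-- The projection of an edc on a set `V` of visible events. -/
def Edc.proj {E : Type*} (P : Edc E) (V : Set E) : Edc V where
  le p q := P.le p q
  le_refl _ := P.le_refl _
  le_trans h h' := P.le_trans h h'
  le_antisymm h h' := Subtype.ext (P.le_antisymm h h')
  Con := {X | Subtype.val '' X ∈ P.Con}
  con_finite h := (P.con_finite h).of_finite_image Subtype.val_injective.injOn
  con_empty := by
    show Subtype.val '' ∅ ∈ P.Con
    rw [Set.image_empty]; exact P.con_empty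
  finite_below e := (P.finite_below e).preimage Subtype.val_injective.injOn
  con_singleton e := by
    show Subtype.val '' {e} ∈ P.Con
    rw [Set.image_singleton]; exact P.con_singleton _
  con_mono h hX := P.con_mono (Set.image_mono h) hX
  con_insert {X e e'} hX h he := by
    show Subtype.val '' insert e X ∈ P.Con
    rw [Set.image_insert_eq]
    exact P.con_insert hX h ⟨e', he, rfl⟩
  equiv p q := P.equiv p q
  equiv_equivalence := ⟨fun _ => P.equiv_equivalence.refl _,
    fun h => P.equiv_equivalence.symm h, fun h h' => P.equiv_equivalence.trans h h'⟩
  disj h₁ h₂ h := Subtype.ext (P.disj h₁ h₂ h)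

/-! ## Composition -/

/-- A set is a configuration of a parallel composition iff its two components are. -/
theorem Edc.par_isConfig_iff {E F : Type*} {P : Edc E} {Q : Edc F} {x : Set (E ⊕ F)} :
    (P.par Q).IsConfig x ↔ P.IsConfig (Sum.inl ⁻¹' x) ∧ Q.IsConfig (Sum.inr ⁻¹' x) := by
  constructor
  · intro h
    refine ⟨⟨fun X hX hf => ?_, fun e he e' hle => h.2 _ he _ (.inl hle)⟩,
      ⟨fun X hX hf => ?_, fun e he e' hle => h.2 _ he _ (.inr hle)⟩⟩
    · have := (h.1 (Sum.inl '' X) (by rintro _ ⟨e, he, rfl⟩; exact hX he) (hf.image _)).1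
      rwa [Set.preimage_image_eq _ Sum.inl_injective] at this
    · have := (h.1 (Sum.inr '' X) (by rintro _ ⟨e, he, rfl⟩; exact hX he) (hf.image _)).2
      rwa [Set.preimage_image_eq _ Sum.inr_injective] at this
  · intro h
    refine ⟨fun X hX hf => ⟨h.1.1 _ (Set.preimage_mono hX) (hf.preimage Sum.inl_injective.injOn),
      h.2.1 _ (Set.preimage_mono hX) (hf.preimage Sum.inr_injective.injOn)⟩, ?_⟩
    rintro e he e' hle
    cases hle with
    | inl hle => exact h.1.2 _ he _ hle
    | inr hle => exact h.2.2 _ he _ hle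

theorem Edc.par_isFinConfig_iff {E F : Type*} {P : Edc E} {Q : Edc F} {x : Set (E ⊕ F)} :
    (P.par Q).IsFinConfig x ↔ P.IsFinConfig (Sum.inl ⁻¹' x) ∧ Q.IsFinConfig (Sum.inr ⁻¹' x) := by
  have hfin : x.Finite ↔ (Sum.inl ⁻¹' x).Finite ∧ (Sum.inr ⁻¹' x).Finite := by
    constructor
    · intro h
      exact ⟨h.preimage Sum.inl_injective.injOn, h.preimage Sum.inr_injective.injOn⟩
    · intro h
      refine ((h.1.image Sum.inl).union (h.2.image Sum.inr)).subset ?_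
      rintro (e | e) he
      · exact Or.inl ⟨e, he, rfl⟩
      · exact Or.inr ⟨e, he, rfl⟩
  constructor
  · rintro ⟨h, hf⟩
    have h1 := Edc.par_isConfig_iff.1 h
    have h2 := hfin.1 hf
    exact ⟨⟨h1.1, h2.1⟩, ⟨h1.2, h2.2⟩⟩
  · rintro ⟨h, h'⟩
    exact ⟨Edc.par_isConfig_iff.2 ⟨h.1, h'.1⟩, hfin.2 ⟨h.2, h'.2⟩⟩

/-- The identity map. -/
def EdcMap.id {E : Type*} (P : Edc E) : EdcMap P P where
  toFun e := e
  map_equiv h := h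
  map_config h := by rwa [Set.image_id']
  locally_inj _ _ _ _ _ h := h

/-- Composition of total maps of edc's. -/
def EdcMap.comp {E F G : Type*} {P : Edc E} {Q : Edc F} {R : Edc G} (g : EdcMap Q R)
    (f : EdcMap P Q) : EdcMap P R where
  toFun e := g.toFun (f.toFun e)
  map_equiv h := g.map_equiv (f.map_equiv h)
  map_config {x} h := by
    rw [← Set.image_image g.toFun f.toFun x]
    exact g.map_config (f.map_config h)
  locally_inj {x} hx p hp q hq h :=
    f.locally_inj hx p hp q hq
      (g.locally_inj (f.map_config hx) _ ⟨p, hp, rfl⟩ _ ⟨q, hq, rfl⟩ h)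

/-- The parallel composition `f ∥ g` of total maps of edc's. -/
def EdcMap.par {E F E' F' : Type*} {P : Edc E} {Q : Edc F} {P' : Edc E'} {Q' : Edc F'}
    (f : EdcMap P P') (g : EdcMap Q Q') : EdcMap (P.par Q) (P'.par Q') where
  toFun := Sum.map f.toFun g.toFun
  map_equiv h := by
    cases h with
    | inl h => exact .inl (f.map_equiv h)
    | inr h => exact .inr (g.map_equiv h)
  map_config {x} hx := by
    rw [Edc.par_isFinConfig_iff] at hx ⊢
    have h₁ : Sum.inl ⁻¹' (Sum.map f.toFun g.toFun '' x) = f.toFun '' (Sum.inl ⁻¹' x) := by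
      ext e; simp
    have h₂ : Sum.inr ⁻¹' (Sum.map f.toFun g.toFun '' x) = g.toFun '' (Sum.inr ⁻¹' x) := by
      ext e; simp
    rw [h₁, h₂]
    exact ⟨f.map_config hx.1, g.map_config hx.2⟩
  locally_inj {x} hx p hp q hq h := by
    rw [Edc.par_isFinConfig_iff] at hx
    rcases p with p | p <;> rcases q with q | q
    · cases h with | inl h => exact .inl (f.locally_inj hx.1 p hp q hq h)
    · cases h
    · cases h
    · cases h with | inr h => exact .inr (g.locally_inj hx.2 p hp q hq h)

/-- The associativity of parallel composition. -/
def EdcMap.assoc {E F G : Type*} (P : Edc E) (Q : Edc F) (R : Edc G) :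
    EdcMap ((P.par Q).par R) (P.par (Q.par R)) where
  toFun := Equiv.sumAssoc E F G
  map_equiv h := by
    cases h with
    | inl h =>
      cases h with
      | inl h => exact .inl h
      | inr h => exact .inr (.inl h)
    | inr h => exact .inr (.inr h)
  map_config {x} hx := by
    rw [Edc.par_isFinConfig_iff, Edc.par_isFinConfig_iff] at hx ⊢
    have h₁ : Sum.inl ⁻¹' (Equiv.sumAssoc E F G '' x) = Sum.inl ⁻¹' (Sum.inl ⁻¹' x) := by
      ext e; simp
    have h₂ : Sum.inl ⁻¹' (Sum.inr ⁻¹' (Equiv.sumAssoc E F G '' x)) =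
        Sum.inr ⁻¹' (Sum.inl ⁻¹' x) := by
      ext e; simp
    have h₃ : Sum.inr ⁻¹' (Sum.inr ⁻¹' (Equiv.sumAssoc E F G '' x)) = Sum.inr ⁻¹' x := by
      ext e; simp
    rw [h₁, h₂, h₃]
    exact ⟨hx.1.1, hx.1.2, hx.2⟩
  locally_inj {x} hx p hp q hq h := by
    rcases p with (p | p) | p <;> rcases q with (q | q) | q <;> rcases h with h | (h | h)
    · exact .inl (.inl h)
    · exact .inl (.inr h)
    · exact .inr h

theorem StableFamily.Prime.exists_sub {D : Type*} {𝓕 : StableFamily D} (p : 𝓕.Prime) {d : D}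
    (hd : d ∈ p.carrier) : ∃ q : 𝓕.Prime, q.carrier ⊆ p.carrier ∧ q.top = d := by
  have hf : {y | y ∈ 𝓕.F ∧ d ∈ y ∧ y ⊆ p.carrier}.Finite :=
    p.finite.finite_subsets.subset fun y hy => hy.2.2
  obtain ⟨y, hy⟩ := hf.exists_minimal ⟨p.carrier, p.mem, hd, subset_rfl⟩
  refine ⟨⟨y, d, hy.prop.1, p.unambiguous.mono hy.prop.2.2, hy.prop.2.1, fun w hw hdw hwy => ?_⟩,
    hy.prop.2.2, rfl⟩
  exact hwy.antisymm (hy.le_of_le ⟨hw, hdw, hwy.trans hy.prop.2.2⟩ hwy)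

/-- The partial map `A ∥ (B ∥ C) ⇀ A ∥ C`, undefined on `B`. -/
def hideMiddle {α β γ : Type*} : α ⊕ (β ⊕ γ) → Option (α ⊕ γ)
  | .inl a => some (.inl a)
  | .inr (.inl _) => none
  | .inr (.inr c) => some (.inr c)

theorem hideMiddle_equiv_iff {α β γ : Type*} {A : Edc α} {B : Edc β} {C : Edc γ}
    {u w : α ⊕ (β ⊕ γ)} {u' w' : α ⊕ γ} (hu : hideMiddle u = some u') (hw : hideMiddle w = some w') :
    (A.par (B.par C)).equiv u w ↔ (A.par C).equiv u' w' := by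
  rcases u with a | b | c <;> rcases w with a' | b' | c' <;>
    simp only [hideMiddle, Option.some.injEq, reduceCtorEq] at hu hw <;> subst hu hw <;>
    simp [Edc.par]

section Composition

variable {α β γ ς θ : Type*} {A : EdcPol α} {B : EdcPol β} {C : EdcPol γ}
  {S : EdcPol ς} {T : EdcPol θ}

/-- The map `σ ∥ C : S ∥ C → A ∥ B ∥ C`, ignoring polarities. -/
def leftMap (C : EdcPol γ) (σ : PreStrategy S (A.dual.par B)) :
    EdcMap (S.toEdc.par C.toEdc) (A.toEdc.par (B.toEdc.par C.toEdc)) :=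
  (EdcMap.assoc A.toEdc B.toEdc C.toEdc).comp (σ.toEdcMap.par (EdcMap.id C.toEdc))

/-- The map `A ∥ τ : A ∥ T → A ∥ B ∥ C`, ignoring polarities. -/
def rightMap (A : EdcPol α) (τ : PreStrategy T (B.dual.par C)) :
    EdcMap (A.toEdc.par T.toEdc) (A.toEdc.par (B.toEdc.par C.toEdc)) :=
  (EdcMap.id A.toEdc).par τ.toEdcMap

variable (σ : PreStrategy S (A.dual.par B)) (τ : PreStrategy T (B.dual.par C))

/-- Events of the pullback of `σ ∥ C` and `A ∥ τ`. -/
abbrev SyncEvent : Type _ := (pbFamily (leftMap C σ) (rightMap A τ)).Prime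

/-- The composition before hiding: the pullback of `σ ∥ C` and `A ∥ τ` in edc's. -/
def sync : Edc (SyncEvent σ τ) := Edc.pullback (leftMap C σ) (rightMap A τ)

variable {σ τ}

/-- The projection `π₁` of the pullback to `S ∥ C`. -/
def SyncEvent.left (p : SyncEvent σ τ) : ς ⊕ γ := p.top.fst

/-- The projection `π₂` of the pullback to `A ∥ T`. -/
def SyncEvent.right (p : SyncEvent σ τ) : α ⊕ θ := p.top.snd

/-- The common image in `A ∥ B ∥ C`. -/
def SyncEvent.image (p : SyncEvent σ τ) : α ⊕ (β ⊕ γ) := (leftMap C σ).toFun p.left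

variable (σ τ)

/-- The visible events: those over `A` and `C`. -/
def visible : Set (SyncEvent σ τ) := {p | (hideMiddle p.image).isSome}

/-- The action of the composition on events. -/
def compFun (p : visible σ τ) : α ⊕ γ := (hideMiddle p.1.image).get p.2

theorem compFun_eq (p : visible σ τ) : hideMiddle p.1.image = some (compFun σ τ p) :=
  (Option.some_get p.2).symm

theorem compFun_equiv {p q : visible σ τ} (h : (sync σ τ).equiv p q) :
    (A.toEdc.par C.toEdc).equiv (compFun σ τ p) (compFun σ τ q) :=
  (hideMiddle_equiv_iff (compFun_eq σ τ p) (compFun_eq σ τ q)).1 ((leftMap C σ).map_equiv h.1)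

/-- The edc with polarity `T ⊙ S`: the events over `B` are hidden. -/
def compEdc : EdcPol (visible σ τ) where
  toEdc := (sync σ τ).proj (visible σ τ)
  pol p := (A.dual.par C).pol (compFun σ τ p)
  pol_equiv h := (A.dual.par C).pol_equiv (compFun_equiv σ τ h)

theorem compEdc_union_mem {x : Set (visible σ τ)} (hx : (compEdc σ τ).IsFinConfig x) :
    PbStableConfig (⋃ p ∈ x, p.1.carrier) := by
  have h : ⋃ p ∈ (Subtype.val '' x : Set (SyncEvent σ τ)), p.carrier ∈ (pbFamily _ _).F :=
    (hx.1.1 x subset_rfl hx.2).2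
  rwa [Set.biUnion_image] at h

theorem mem_compFun_image_iff {x : Set (visible σ τ)} (hx : (compEdc σ τ).IsFinConfig x)
    {u : α ⊕ (β ⊕ γ)} {u' : α ⊕ γ} (hu : hideMiddle u = some u') :
    u' ∈ compFun σ τ '' x ↔
      u ∈ (leftMap C σ).toFun '' (PbEvent.fst '' ⋃ p ∈ x, p.1.carrier) := by
  have hinj : ∀ {u w : α ⊕ (β ⊕ γ)} {u' : α ⊕ γ}, hideMiddle u = some u' →
      hideMiddle w = some u' → u = w := by
    intro u w u' hu hw
    rcases u with a | b | c <;> rcases w with a' | b' | c' <;> simp_all [hideMiddle] <;>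
      (subst hu; simp_all)
  constructor
  · rintro ⟨p, hp, rfl⟩
    exact ⟨_, ⟨p.1.top, Set.mem_biUnion hp p.1.top_mem, rfl⟩, hinj (compFun_eq σ τ p) hu⟩
  · rintro ⟨_, ⟨d, hd, rfl⟩, rfl⟩
    obtain ⟨p, hp, hd⟩ := Set.mem_iUnion₂.1 hd
    obtain ⟨q, hq, rfl⟩ := p.1.exists_sub hd
    have hv : q ∈ visible σ τ := by
      show (hideMiddle ((leftMap C σ).toFun q.top.fst)).isSome
      rw [hu]; rfl
    refine ⟨⟨q, hv⟩, hx.1.2 p hp ⟨q, hv⟩ hq, ?_⟩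
    have := compFun_eq σ τ ⟨q, hv⟩
    exact Option.some.inj (this.symm.trans hu)

/-- The composition `τ ⊙ σ : T ⊙ S → Aᗮ ∥ C`. -/
def comp : PreStrategy (compEdc σ τ) (A.dual.par C) where
  toFun := compFun σ τ
  map_equiv h := compFun_equiv σ τ h
  map_config {x} hx := by
    have hm := compEdc_union_mem σ τ hx
    have hfin : (⋃ p ∈ x, p.1.carrier).Finite := hx.2.biUnion fun p _ => p.1.finite
    have h := (leftMap C σ).map_config ⟨hm.1.1.1, hfin.image _⟩
    rw [Edc.par_isFinConfig_iff, Edc.par_isFinConfig_iff] at h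
    refine Edc.par_isFinConfig_iff.2 ⟨?_, ?_⟩
    · rw [show Sum.inl ⁻¹' (compFun σ τ '' x) = _ from
        Set.ext fun a => mem_compFun_image_iff σ τ hx (u := .inl a) rfl]
      exact h.1
    · rw [show Sum.inr ⁻¹' (compFun σ τ '' x) = _ from
        Set.ext fun c => mem_compFun_image_iff σ τ hx (u := .inr (.inr c)) rfl]
      exact h.2.2
  locally_inj {x} hx p hp q hq h := by
    have hm := compEdc_union_mem σ τ hx
    have hp' := Set.mem_biUnion (t := fun p : visible σ τ => p.1.carrier) hp p.1.top_mem
    have hq' := Set.mem_biUnion (t := fun p : visible σ τ => p.1.carrier) hq q.1.top_mem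
    have h' : (A.toEdc.par (B.toEdc.par C.toEdc)).equiv p.1.image q.1.image :=
      (hideMiddle_equiv_iff (compFun_eq σ τ p) (compFun_eq σ τ q)).2 h
    refine ⟨(leftMap C σ).locally_inj' hm.1.1.1 ⟨_, hp', rfl⟩ ⟨_, hq', rfl⟩ h',
      (rightMap A τ).locally_inj' hm.1.1.2 ⟨_, hp', rfl⟩ ⟨_, hq', rfl⟩ ?_⟩
    rw [← p.1.top.comm, ← q.1.top.comm]
    exact h'
  map_pol _ := rfl

/-- The `S`-component of the projection to `S ∥ C` of the down-closure, before hiding, of `x`. -/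
def projS (x : Set (visible σ τ)) : Set ς :=
  Sum.inl ⁻¹' (SyncEvent.left '' (sync σ τ).down (Subtype.val '' x))

/-- The `T`-component of the projection to `A ∥ T` of the down-closure, before hiding, of `x`. -/
def projT (x : Set (visible σ τ)) : Set θ :=
  Sum.inr ⁻¹' (SyncEvent.right '' (sync σ τ).down (Subtype.val '' x))

/-- The product of valuations on the composition. -/
def compVal (vS : Set ς → ℝ) (vT : Set θ → ℝ) (x : Set (visible σ τ)) : ℝ :=
  vS (projS σ τ x) * vT (projT σ τ x)

end Composition

/-!
# Composition of probabilistic edc strategies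

The moves of `A ∥ (B ∥ C)` fall into three disjoint classes: those played by `σ` (the Player moves
of `Aᗮ ∥ B`), those played by `τ` (the Player moves of `Bᗮ ∥ C`), and those of the environment.
Every move over `B` is played by exactly one of the two strategies, so environment moves are
visible, and the Player moves of the composition are the visible moves played by `σ` or `τ`. Reading
the moves of `C` as Opponent moves for `σ`, and those of `A` as Opponent moves for `τ`, both
`σ ∥ C` and `A ∥ τ` become strategies over one arena. `IsArena` and `IsComponent` record what is
needed of this situation, symmetrically in the two strategies. As `A`, `B`, `C` are games and the
strategies are saturated, two events of the pullback are equivalent iff they have the same image in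
the arena.

*Causality.* An immediate causal dependency of the pullback comes from one in `S ∥ C` or one in
`A ∥ T` (`pullback_imm`). By innocence it is already one of the arena if its target is an environment
move or its source is a visible Player move (`pullback_imm_image`). As `A`, `B` and `C` are causally
unrelated, hiding then preserves innocence. It also follows that the immediate causes of an
environment move are visible, so that each event played by one of the strategies, below a visible
event `p`, is below a visible Player move which is itself below `p` (`exists_visible_between`). Hence
Player moves of a down-closed set determine the consistency of its projections, which gives
`+`-consistency, and the events below an environment move are determined by the visible ones, which
gives non-redundancy with the help of `IsComponent.eq_of_image_eq`.

*Valuation.* The drop of the composition is the alternating sum `altSum` of the product of the two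
valuations, extended by zero, over unions of sets of events of the pullback. Replacing one extension
`x i` of `y` by a single event `d` of it, and adding `d` to `y`, splits this sum in two
(`altSum_split`), so it suffices to treat extensions by single events. Each of these is due to one
of the strategies alone. If `z₁` extends `y` by moves of `σ` and `z₂` extends it by moves of `τ`, then
`z₁ ∪ z₂` is a configuration iff the projections of `z₁` to `S ∥ C` and of `z₂` to `A ∥ T` are, by
race-freeness and `+`-consistency, and the product of the valuations at `z₁ ∪ z₂` is
`v_S(z₁) * v_T(z₂)`, as the valuations ignore Opponent moves (`pbVal_union`). So the drop is
the product of a drop for `σ` and one for `τ`, both of which are nonnegative.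
-/

/-! ### Finite configurations of event structures -/

namespace EventStructure

variable {E : Type*} {P : EventStructure E}

theorem isFinConfig_of_mem_con {X : Set E} (h : X ∈ P.Con)
    (hd : ∀ e ∈ X, ∀ e', P.le e' e → e' ∈ X) : P.IsFinConfig X :=
  ⟨⟨fun _ hY _ => P.con_mono hY h, hd⟩, P.con_finite h⟩

theorem IsFinConfig.mem_con {x : Set E} (h : P.IsFinConfig x) : x ∈ P.Con :=
  h.1.1 x subset_rfl h.2

theorem IsFinConfig.of_subset {x y : Set E} (h : P.IsFinConfig x) (hyx : y ⊆ x)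
    (hd : ∀ e ∈ y, ∀ e', P.le e' e → e' ∈ y) : P.IsFinConfig y :=
  isFinConfig_of_mem_con (P.con_mono hyx h.mem_con) hd

theorem down_eq_self {x : Set E} (hd : ∀ e ∈ x, ∀ e', P.le e' e → e' ∈ x) : P.down x = x :=
  Set.Subset.antisymm (fun _ ⟨e', he', h⟩ => hd e' he' _ h) fun e he => ⟨e, he, P.le_refl e⟩

theorem down_finite {X : Set E} (hX : X.Finite) : (P.down X).Finite := by
  refine (hX.biUnion fun e _ => P.finite_below e).subset ?_
  rintro e ⟨e', he', h⟩
  exact Set.mem_biUnion he' h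

theorem down_mem_con {X : Set E} (hX : X ∈ P.Con) : P.down X ∈ P.Con := by
  have key : ∀ Y : Set E, Y.Finite → Y ⊆ P.down X → X ∪ Y ∈ P.Con := by
    intro Y hY
    induction Y, hY using Set.Finite.induction_on with
    | empty => intro _; simpa using hX
    | @insert a Y _ _ ih =>
      intro h
      obtain ⟨e', he', hle⟩ := h (Set.mem_insert a Y)
      rw [Set.union_insert]
      exact P.con_insert (ih fun _ hy => h (Set.mem_insert_of_mem _ hy)) hle (Or.inl he')
  exact P.con_mono Set.subset_union_right (key _ (down_finite (P.con_finite hX)) subset_rfl)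

theorem isFinConfig_down_singleton (e : E) : P.IsFinConfig (P.down {e}) :=
  isFinConfig_of_mem_con (down_mem_con (P.con_singleton e))
    fun _ ⟨a, ha, h⟩ _ h' => ⟨a, ha, P.le_trans h' h⟩

theorem ncard_below_lt {a b : E} (h : P.le a b) (hne : a ≠ b) :
    {e | P.le e a}.ncard < {e | P.le e b}.ncard := by
  refine Set.ncard_lt_ncard ⟨fun e he => P.le_trans he h, fun hs => hne ?_⟩ (P.finite_below b)
  exact P.le_antisymm h (hs (P.le_refl b))

theorem exists_imm_right {a b : E} (h : P.le a b) (hne : a ≠ b) :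
    ∃ c, P.le a c ∧ P.Imm c b := by
  have hf : {c | P.le a c ∧ P.le c b ∧ c ≠ b}.Finite := (P.finite_below b).subset fun c hc => hc.2.1
  obtain ⟨c, hc, hmax⟩ := Set.exists_max_image _ (fun c => {e | P.le e c}.ncard) hf
    ⟨a, P.le_refl a, h, hne⟩
  refine ⟨c, hc.1, hc.2.1, hc.2.2, fun d hcd hdb => ?_⟩
  by_contra! hd
  have h1 := hmax d ⟨P.le_trans hc.1 hcd, hdb, hd.2⟩
  have h2 := ncard_below_lt hcd hd.1.symm
  omega

theorem exists_imm_left {a b : E} (h : P.le a b) (hne : a ≠ b) :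
    ∃ c, P.Imm a c ∧ P.le c b := by
  have hf : {c | P.le a c ∧ P.le c b ∧ c ≠ a}.Finite := (P.finite_below b).subset fun c hc => hc.2.1
  obtain ⟨c, hc, hmin⟩ := Set.exists_min_image _ (fun c => {e | P.le e c}.ncard) hf
    ⟨b, h, P.le_refl b, hne.symm⟩
  refine ⟨c, ⟨hc.1, hc.2.2.symm, fun d had hdc => ?_⟩, hc.2.1⟩
  by_contra! hd
  have h1 := hmin d ⟨had, P.le_trans hdc hc.2.1, hd.1⟩
  have h2 := ncard_below_lt hdc hd.2
  omega

theorem exists_isFinConfig_insert {y u : Set E} (hy : P.IsFinConfig y) (hu : P.IsFinConfig u)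
    (hyu : y ⊆ u) (hne : y ≠ u) : ∃ b ∈ u, b ∉ y ∧ P.IsFinConfig (insert b y) := by
  obtain ⟨b₀, hb₀, hb₀'⟩ := Set.exists_of_ssubset (hyu.ssubset_of_ne hne)
  obtain ⟨b, hb, hmin⟩ := Set.exists_min_image (u \ y) (fun c => {e | P.le e c}.ncard)
    (hu.2.subset Set.sdiff_subset) ⟨b₀, hb₀, hb₀'⟩
  refine ⟨b, hb.1, hb.2, hu.of_subset (Set.insert_subset hb.1 hyu) ?_⟩
  rintro e (rfl | he) e' hle
  · by_contra hn
    simp only [Set.mem_insert_iff, not_or] at hn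
    have h1 := hmin e' ⟨hu.1.2 _ hb.1 _ hle, hn.2⟩
    have h2 := ncard_below_lt hle hn.1
    omega
  · exact Or.inr (hy.1.2 _ he _ hle)

end EventStructure

/-! ### Race-freeness for sets of moves -/

namespace EdcPol

variable {E : Type*} {P : EdcPol E}

theorem RaceFree.insert_of_subPlus (h : P.RaceFree) {a : E} (ha : P.pol a = .minus) {y u : Set E}
    (hu : P.IsFinConfig u) (hya : P.IsFinConfig (insert a y)) (hy : P.IsFinConfig y)
    (hyu : P.SubPlus y u) : P.IsFinConfig (insert a u) := by
  induction hn : (u \ y).ncard using Nat.strong_induction_on generalizing y with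
  | _ n ih =>
    by_cases hay : a ∈ y
    · rwa [Set.insert_eq_of_mem (hyu.1 hay)]
    by_cases hne : y = u
    · rwa [← hne]
    obtain ⟨b, hb, hby, hyb⟩ := EventStructure.exists_isFinConfig_insert hy hu hyu.1 hne
    have hbp := hyu.2 b hb hby
    have hab := h y a b ⟨hy, hay, hya⟩ ⟨hy, hby, hyb⟩ (by rw [ha, hbp]; simp)
    refine ih _ ?_ (y := insert b y) ?_ hyb ⟨Set.insert_subset hb hyu.1, fun e he hn =>
      hyu.2 e he fun h => hn (Or.inr h)⟩ rfl
    · rw [← hn]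
      refine Set.ncard_lt_ncard ⟨fun e he => ⟨he.1, fun h => he.2 (Or.inr h)⟩, fun hs => ?_⟩
        (hu.2.subset Set.sdiff_subset)
      exact (hs ⟨hb, hby⟩).2 (Or.inl rfl)
    · convert hab using 1
      ext e; simp

/-- Race-freeness, stated for single moves, extends to compatibility of any extension by Player
with any extension by Opponent. -/
theorem RaceFree.union (h : P.RaceFree) {y u w : Set E} (hy : P.IsFinConfig y)
    (hu : P.IsFinConfig u) (hw : P.IsFinConfig w) (hyu : P.SubPlus y u) (hyw : P.SubMinus y w) :
    P.IsFinConfig (u ∪ w) := by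
  induction hn : (w \ y).ncard using Nat.strong_induction_on generalizing y u with
  | _ n ih =>
    by_cases hne : y = w
    · rwa [← hne, Set.union_eq_left.2 hyu.1]
    obtain ⟨a, ha, hay, hya⟩ := EventStructure.exists_isFinConfig_insert hy hw hyw.1 hne
    have hua := h.insert_of_subPlus (hyw.2 a ha hay) hu hya hy hyu
    have := ih _ ?_ hya hua ⟨Set.insert_subset_insert hyu.1, ?_⟩
      ⟨Set.insert_subset ha hyw.1, fun e he hn => hyw.2 e he fun h => hn (Or.inr h)⟩ rfl
    · rwa [Set.insert_union, Set.insert_eq_of_mem (show a ∈ u ∪ w from Or.inr ha)] at this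
    · rw [← hn]
      refine Set.ncard_lt_ncard ⟨fun e he => ⟨he.1, fun h => he.2 (Or.inr h)⟩, fun hs => ?_⟩
        (hw.2.subset Set.sdiff_subset)
      exact (hs ⟨ha, hay⟩).2 (Or.inl rfl)
    · rintro e (rfl | he) hn
      · exact absurd (Or.inl rfl) hn
      · exact hyu.2 e he fun h => hn (Or.inr h)

end EdcPol

/-! ### Alternating sums over finite sets of indices -/

/-- The alternating sum of `φ` over the subsets of `s`. For `φ K = v (y ∪ ⋃ i ∈ K, x i)`, with `v`
extended by zero outside the configurations, it is the drop of `v` across the generalised interval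
from `y` to the `x i`. -/
def altSum {ι : Type*} (s : Finset ι) (φ : Finset ι → ℝ) : ℝ :=
  ∑ K ∈ s.powerset, (-1 : ℝ) ^ K.card * φ K

theorem altSum_congr {ι : Type*} {s : Finset ι} {φ ψ : Finset ι → ℝ}
    (h : ∀ K ⊆ s, φ K = ψ K) : altSum s φ = altSum s ψ :=
  Finset.sum_congr rfl fun K hK => by rw [h K (Finset.mem_powerset.1 hK)]

theorem altSum_eq_zero {ι : Type*} {s : Finset ι} {φ : Finset ι → ℝ}
    (h : ∀ K ⊆ s, φ K = 0) : altSum s φ = 0 :=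
  Finset.sum_eq_zero fun K hK => by rw [h K (Finset.mem_powerset.1 hK), mul_zero]

theorem altSum_insert {ι : Type*} [DecidableEq ι] {s : Finset ι} {i : ι} (hi : i ∉ s)
    (φ : Finset ι → ℝ) :
    altSum (insert i s) φ = altSum s φ - altSum s fun K => φ (insert i K) := by
  rw [altSum, Finset.sum_powerset_insert hi, sub_eq_add_neg, altSum, altSum,
    ← Finset.sum_neg_distrib]
  congr 1
  refine Finset.sum_congr rfl fun K hK => ?_
  rw [Finset.card_insert_of_notMem fun h => hi (Finset.mem_powerset.1 hK h), pow_succ]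
  ring

theorem altSum_map {ι κ : Type*} (e : κ ↪ ι) (s : Finset κ) (φ : Finset ι → ℝ) :
    altSum (s.map e) φ = altSum s fun K => φ (K.map e) := by
  classical
  induction s using Finset.induction_on generalizing φ with
  | empty => simp [altSum]
  | insert i s hi ih =>
    rw [Finset.map_insert, altSum_insert (by simpa using hi), altSum_insert hi, ih, ih]
    simp_rw [Finset.map_insert]

theorem altSum_mul {ι : Type*} [DecidableEq ι] (p : ι → Prop) [DecidablePred p] (s : Finset ι)
    {φ a b : Finset ι → ℝ}
    (h : ∀ K ⊆ s, φ K = a (K.filter p) * b (K.filter fun i => ¬ p i)) :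
    altSum s φ = altSum (s.filter p) a * altSum (s.filter fun i => ¬ p i) b := by
  induction s using Finset.induction_on generalizing φ a b with
  | empty => simpa [altSum] using h ∅ subset_rfl
  | insert i s hi ih =>
    rw [altSum_insert hi, ih fun K hK => h K (hK.trans (Finset.subset_insert i s))]
    by_cases hp : p i
    · rw [Finset.filter_insert, if_pos hp, Finset.filter_insert, if_neg (not_not.2 hp),
        altSum_insert (by simp [hi]), ih (a := fun K => a (insert i K)) (b := b), sub_mul]
      intro K hK
      rw [h _ (Finset.insert_subset_insert i hK), Finset.filter_insert, if_pos hp,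
        Finset.filter_insert, if_neg (not_not.2 hp)]
    · rw [Finset.filter_insert, if_neg hp, Finset.filter_insert, if_pos hp,
        altSum_insert (by simp [hi]), ih (a := a) (b := fun K => b (insert i K)), mul_sub]
      intro K hK
      rw [h _ (Finset.insert_subset_insert i hK), Finset.filter_insert, if_neg hp,
        Finset.filter_insert, if_pos hp]

/-! ### Immediate causality in the pullback -/

namespace StableFamily

variable {D : Type*} {𝓕 : StableFamily D}

theorem mem_of_forall_mem {x z : Set D} (hz : z ∈ 𝓕.F) (hxz : x ⊆ z)
    (h : ∀ d ∈ x, ∃ w ∈ 𝓕.F, d ∈ w ∧ w ⊆ x) : x ∈ 𝓕.F := by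
  have hx : ⋃₀ {w | w ∈ 𝓕.F ∧ w ⊆ x} = x := by
    refine Set.Subset.antisymm (Set.sUnion_subset fun w hw => hw.2) fun d hd => ?_
    obtain ⟨w, hw, hdw, hwx⟩ := h d hd
    exact ⟨w, ⟨hw, hwx⟩, hdw⟩
  rw [← hx]
  exact 𝓕.sUnion_mem _ (fun w hw => hw.1) fun Y hY _ => ⟨z, hz, fun y hy => (hY hy).2.trans hxz⟩

theorem Prime.eq_of_top_mem {p q : 𝓕.Prime} (h : q.carrier ⊆ p.carrier)
    (ht : p.top ∈ q.carrier) : q = p :=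
  Prime.ext' (p.least _ q.mem ht h)

theorem Prime.eq_of_top_eq {p q r : 𝓕.Prime} (hp : p.carrier ⊆ r.carrier)
    (hq : q.carrier ⊆ r.carrier) (h : p.top = q.top) : p = q :=
  𝓕.primes.disj hp hq (by show 𝓕.equiv _ _; rw [h]; exact 𝓕.equiv_equivalence.refl _)

/-- Removing the top `p'.top` and the top of an immediate predecessor from a prime configuration
leaves a configuration. -/
theorem Prime.diff_pair_mem {p p' : 𝓕.Prime} (h : 𝓕.primes.Imm p p') :
    p'.carrier \ {p.top, p'.top} ∈ 𝓕.F := by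
  refine mem_of_forall_mem p'.mem Set.sdiff_subset fun d hd => ?_
  obtain ⟨q, hq, rfl⟩ := p'.exists_sub hd.1
  refine ⟨_, q.mem, q.top_mem, fun e he => ⟨hq he, ?_⟩⟩
  have hd2 := hd.2
  simp only [Set.mem_insert_iff, Set.mem_singleton_iff, not_or] at hd2
  rintro (rfl | rfl)
  · obtain ⟨r, hr, hrt⟩ := q.exists_sub he
    have hrp : r = p := Prime.eq_of_top_eq (hr.trans hq) h.1 hrt
    subst hrp
    rcases h.2.2 q hr hq with rfl | rfl
    · exact hd2.1 rfl
    · exact hd2.2 rfl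
  · exact hd2.2 (congrArg _ (Prime.eq_of_top_mem hq he))

end StableFamily

section Pullback

variable {E F G : Type*} {P : Edc E} {Q : Edc F} {R : Edc G} {f : EdcMap P R} {g : EdcMap Q R}

/-- Within an unambiguous configuration, being matching is enough for being a configuration: the
securing sequences restrict. -/
theorem PbConfig.of_subset_matching {z y : Set (PbEvent f g)} (hz : PbConfig z)
    (hu : Unambiguous PbEquiv z) (hyz : y ⊆ z) (hy : PbMatching y) : PbConfig y := by
  classical
  refine ⟨hy, fun d hd => ?_⟩
  obtain ⟨l, hl, hp⟩ := hz.2 d (hyz hd)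
  refine ⟨l.filter (· ∈ y), fun e he => by simpa using (List.mem_filter.1 he).2,
    fun l' hl' => ?_⟩
  have hf : l.filter (· ∈ y) ++ [d] = (l ++ [d]).filter (· ∈ y) := by
    simp [List.filter_append, hd]
  rw [hf, List.prefix_filter_iff] at hl'
  obtain ⟨m, hm, rfl⟩ := hl'
  have hs : {e | e ∈ m.filter (· ∈ y)} = {e | e ∈ m} ∩ y := by
    ext e; simp [List.mem_filter]
  rw [hs]
  refine hz.1.inter hu ?_ hyz (hp m hm) hy
  intro e he
  rcases List.mem_append.1 (hm.subset he) with h | h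
  · exact hl e h
  · rw [List.mem_singleton.1 h]; exact hyz hd

/-- For either projection `φ` of the pullback: if the image of `z` minus two events `d`, `d'` is a
configuration but that of `z` minus `d` is not, then `d` causes `d'` immediately on that side. -/
theorem imm_of_not_isConfig {D : Type*} {φ : D → E} {z : Set D} {d d' : D}
    (hinj : Set.InjOn φ z) (hz : P.IsConfig (φ '' z)) (hd : d ∈ z) (hd' : d' ∈ z) (hne : d ≠ d')
    (hz' : P.IsConfig (φ '' (z \ {d, d'}))) (hn : ¬ P.IsConfig (φ '' (z \ {d}))) :
    P.Imm (φ d) (φ d') := by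
  have hnot : φ d ∉ φ '' (z \ {d, d'}) := by
    rintro ⟨b, hb, h⟩
    exact hb.2 (Or.inl (hinj hb.1 hd h))
  have hle : P.le (φ d) (φ d') := by
    by_contra hle
    refine hn ⟨fun X hX => hz.1 X (hX.trans (Set.image_mono Set.sdiff_subset)), ?_⟩
    rintro _ ⟨b, hb, rfl⟩ e he
    obtain ⟨c, hc, rfl⟩ := hz.2 _ ⟨b, hb.1, rfl⟩ _ he
    refine ⟨c, ⟨hc, ?_⟩, rfl⟩
    rintro rfl
    by_cases hbd : b = d'
    · exact hle (hbd ▸ he)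
    · exact hnot (hz'.2 _ ⟨b, ⟨hb.1, fun h => h.elim hb.2 hbd⟩, rfl⟩ _ he)
  refine ⟨hle, fun h => hne (hinj hd hd' h), fun e h1 h2 => ?_⟩
  obtain ⟨b, hb, rfl⟩ := hz.2 _ ⟨d', hd', rfl⟩ _ h2
  by_contra! hb'
  refine hnot (hz'.2 _ ⟨b, ⟨hb, ?_⟩, rfl⟩ _ h1)
  rintro (rfl | rfl)
  · exact hb'.1 rfl
  · exact hb'.2 rfl

/-- Immediate causality in the pullback comes from immediate causality in one of the components. -/
theorem pullback_imm {p p' : (pbFamily f g).Prime} (h : (Edc.pullback f g).Imm p p') :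
    P.Imm p.top.fst p'.top.fst ∨ Q.Imm p.top.snd p'.top.snd := by
  have hm : PbStableConfig p'.carrier := p'.mem
  have hm' : PbStableConfig (p'.carrier \ {p.top, p'.top}) := StableFamily.Prime.diff_pair_mem h
  have hp : p.top ∈ p'.carrier := h.1 p.top_mem
  have hne : p.top ≠ p'.top := fun ht =>
    h.2.1 (StableFamily.Prime.eq_of_top_mem h.1 (ht ▸ p.top_mem))
  by_contra! hn
  have h1 : P.IsConfig (PbEvent.fst '' (p'.carrier \ {p.top})) := by
    by_contra hc
    exact hn.1 (imm_of_not_isConfig (hm.1.1.injOn_fst p'.unambiguous) hm.1.1.1 hp p'.top_mem hne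
      hm'.1.1.1 hc)
  have h2 : Q.IsConfig (PbEvent.snd '' (p'.carrier \ {p.top})) := by
    by_contra hc
    exact hn.2 (imm_of_not_isConfig (hm.1.1.injOn_snd p'.unambiguous) hm.1.1.2 hp p'.top_mem hne
      hm'.1.1.2 hc)
  have hF : p'.carrier \ {p.top} ∈ (pbFamily f g).F :=
    (hm.1.of_subset_matching p'.unambiguous Set.sdiff_subset ⟨h1, h2⟩).stable
      (p'.unambiguous.mono Set.sdiff_subset)
  have := p'.least _ hF ⟨p'.top_mem, hne.symm⟩ Set.sdiff_subset
  exact ((Set.ext_iff.1 this p.top).2 hp).2 rfl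

/-! ### Composition as interaction of two strategies in a common arena -/

/-- The common image in `R` of the two components of an event of the pullback. -/
def PbEvent.img (d : PbEvent f g) : G := f.toFun d.fst

theorem PbEvent.img_eq (d : PbEvent f g) : d.img = g.toFun d.snd := d.comm

/-- An arena in which two strategies interact, presented symmetrically: `V` is the set of visible
moves, `U` and `W` are the sets of moves played by the first and by the second strategy. The
remaining moves are those of the environment; they are all visible. No causality links visible and
hidden moves, and no inconsistency involves both (`mem_visible_iff`, `con`); `union` is
race-freeness between the two strategies. For `A ∥ (B ∥ C)`, the visible moves are those of `A` and
`C`. -/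
structure IsArena (R : Edc G) (V U W : Set G) : Prop where
  equiv_eq : ∀ {a b}, R.equiv a b → a = b
  disjoint : ∀ {a}, a ∈ U → a ∉ W
  hidden : ∀ {a}, a ∉ V → a ∈ U ∪ W
  mem_visible_iff : ∀ {a b}, R.le a b → (a ∈ V ↔ b ∈ V)
  con : ∀ {X}, X ∩ V ∈ R.Con → X \ V ∈ R.Con → X ∈ R.Con
  union : ∀ {y u w}, R.IsFinConfig y → R.IsFinConfig u → R.IsFinConfig w → y ⊆ u → y ⊆ w →
    u \ y ⊆ U → w \ y ⊆ W → R.IsFinConfig (u ∪ w)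

/-- The part of the strategy axioms that composition relies on, for a strategy `f` which plays the
moves in `U`, against a strategy which plays those in `W`. Apart from the moves in `U`, all moves
are moves of the opponent of `f`; the ones which are both visible and in `W` do not belong to the
game of `f`, and `f` adds no causality from them. -/
structure IsComponent (f : EdcMap P R) (V U W : Set G) : Prop where
  innocent : ∀ {e e'}, P.Imm e e' →
    (f.toFun e ∈ U ∨ f.toFun e ∈ V ∩ W ∨ f.toFun e' ∉ U) → R.Imm (f.toFun e) (f.toFun e')
  plusConsistent : ∀ {X : Set E}, X.Finite → (∀ e ∈ X, ∀ e', P.le e' e → e' ∈ X) →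
    f.toFun '' X ∈ R.Con → {e ∈ X | f.toFun e ∈ U} ∈ P.Con → X ∈ P.Con
  nonRedundant : ∀ {e e'}, P.strictBelow e = P.strictBelow e' → P.equiv e e' →
    f.toFun e ∉ U → e = e'
  saturated : ∀ {e e'}, f.toFun e = f.toFun e' → P.equiv e e'

variable {V U W : Set G}

namespace IsComponent

/-- The causes of an Opponent move lie over causes of its image, and in an unambiguous set there is
at most one event over each of these. -/
theorem strictBelow_subset (hf : IsComponent f V U W) {x : Set E} {e e' : E}
    (hu : ∀ a ∈ x, ∀ b ∈ x, f.toFun a = f.toFun b → a = b) (he : P.strictBelow e ⊆ x)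
    (he' : P.strictBelow e' ⊆ x) (h : f.toFun e = f.toFun e') (hU : f.toFun e ∉ U) :
    P.strictBelow e ⊆ P.strictBelow e' := by
  rintro s ⟨hs, hne⟩
  obtain ⟨s', hss', himm⟩ := EventStructure.exists_imm_right hs hne
  have hR' := hf.innocent himm (Or.inr (Or.inr hU))
  -- The immediate cause `s'` of `e` lies over an immediate cause of the common image of `e` and
  -- `e'`, and so does some cause `s''` of `e'`.
  have hc := f.map_config (EventStructure.isFinConfig_down_singleton (P := P.toEventStructure) e')
  obtain ⟨s'', ⟨a, rfl, hs''⟩, heq⟩ := hc.1.2 _ ⟨e', ⟨e', rfl, P.le_refl e'⟩, rfl⟩ _ (h ▸ hR'.1)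
  have hne'' : s'' ≠ a := by
    rintro rfl
    exact hR'.2.1 (heq.symm.trans h.symm)
  have hs's : s' = s'' := hu _ (he ⟨himm.1, himm.2.1⟩) _ (he' ⟨hs'', hne''⟩) heq.symm
  subst hs's
  refine ⟨P.le_trans hss' hs'', ?_⟩
  rintro rfl
  exact hne'' (P.le_antisymm hs'' hss')

/-- An Opponent move is determined by its image and an unambiguous set containing its causes. -/
theorem eq_of_image_eq (hf : IsComponent f V U W) {x : Set E} {e e' : E}
    (hu : ∀ a ∈ x, ∀ b ∈ x, f.toFun a = f.toFun b → a = b) (he : P.strictBelow e ⊆ x)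
    (he' : P.strictBelow e' ⊆ x) (h : f.toFun e = f.toFun e') (hU : f.toFun e ∉ U) : e = e' :=
  hf.nonRedundant ((hf.strictBelow_subset hu he he' h hU).antisymm
    (hf.strictBelow_subset hu he' he h.symm (h ▸ hU))) (hf.saturated h) hU

end IsComponent

theorem pullback_imm_image (hf : IsComponent f V U W)
    (hg : IsComponent g V W U) {p p' : (pbFamily f g).Prime} (h : (Edc.pullback f g).Imm p p')
    (hp : p.top.img ∈ V ∧ p.top.img ∈ U ∪ W ∨ p'.top.img ∉ U ∪ W) :
    R.Imm p.top.img p'.top.img := by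
  rcases pullback_imm h with h | h
  · refine hf.innocent h ?_
    rcases hp with ⟨h1, h2 | h2⟩ | h1
    · exact Or.inl h2
    · exact Or.inr (Or.inl ⟨h1, h2⟩)
    · exact Or.inr (Or.inr fun h2 => h1 (Or.inl h2))
  · rw [PbEvent.img_eq] at hp ⊢
    rw [PbEvent.img_eq] at hp ⊢
    refine hg.innocent h ?_
    rcases hp with ⟨h1, h2 | h2⟩ | h1
    · exact Or.inr (Or.inl ⟨h1, h2⟩)
    · exact Or.inl h2
    · exact Or.inr (Or.inr fun h2 => h1 (Or.inr h2))

/-- A move played by one of the strategies below a visible move is below a visible move which is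
itself played by one of the strategies: moves of the environment have only visible immediate
causes. -/
theorem exists_visible_between (hR : IsArena R V U W) (hf : IsComponent f V U W)
    (hg : IsComponent g V W U) {q p : (pbFamily f g).Prime} (hqp : q.carrier ⊆ p.carrier)
    (hp : p.top.img ∈ V) (hq : q.top.img ∈ U ∪ W) :
    ∃ r : (pbFamily f g).Prime, q.carrier ⊆ r.carrier ∧ r.carrier ⊆ p.carrier ∧
      r.top.img ∈ V ∧ r.top.img ∈ U ∪ W := by
  induction hn : p.carrier.ncard using Nat.strong_induction_on generalizing p with
  | _ n ih =>
    by_cases hpU : p.top.img ∈ U ∪ W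
    · exact ⟨p, hqp, subset_rfl, hp, hpU⟩
    have hne : q ≠ p := by rintro rfl; exact hpU hq
    obtain ⟨c, hqc, hc⟩ :=
      EventStructure.exists_imm_right (P := (Edc.pullback f g).toEventStructure) hqp hne
    have himm := pullback_imm_image hf hg hc (Or.inr hpU)
    have hlt : c.carrier ⊂ p.carrier :=
      Set.ssubset_iff_subset_ne.2 ⟨hc.1, fun h => hc.2.1 (StableFamily.Prime.ext' h)⟩
    obtain ⟨r, h1, h2, h3⟩ := ih _ (hn ▸ Set.ncard_lt_ncard hlt p.finite) hqc
      ((hR.mem_visible_iff himm.1).2 hp) rfl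
    exact ⟨r, h1, h2.trans hc.1, h3⟩

/-- The visible events of the pullback. -/
abbrev visibleEvents (f : EdcMap P R) (g : EdcMap Q R) (V : Set G) : Set (pbFamily f g).Prime :=
  {p | p.top.img ∈ V}

/-- The pullback with its hidden events projected away. -/
abbrev hiddenPullback (f : EdcMap P R) (g : EdcMap Q R) (V : Set G) : Edc (visibleEvents f g V) :=
  (Edc.pullback f g).proj (visibleEvents f g V)

theorem hiddenPullback_innocent (hR : IsArena R V U W) (hf : IsComponent f V U W)
    (hg : IsComponent g V W U) {p p' : visibleEvents f g V} (h : (hiddenPullback f g V).Imm p p')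
    (hp : p.1.top.img ∈ U ∪ W ∨ p'.1.top.img ∉ U ∪ W) : R.Imm p.1.top.img p'.1.top.img := by
  have hne : p.1 ≠ p'.1 := fun h' => h.2.1 (Subtype.ext h')
  rcases hp with hp | hp
  · obtain ⟨c, hc, hcp⟩ :=
      EventStructure.exists_imm_left (P := (Edc.pullback f g).toEventStructure) h.1 hne
    have himm := pullback_imm_image hf hg hc (Or.inl ⟨p.2, hp⟩)
    have hcV : c.top.img ∈ V := (hR.mem_visible_iff himm.1).1 p.2
    rcases h.2.2 ⟨c, hcV⟩ hc.1 hcp with hcp | hcp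
    · exact absurd (congrArg Subtype.val hcp).symm hc.2.1
    · rw [← hcp]; exact himm
  · obtain ⟨c, hpc, hc⟩ :=
      EventStructure.exists_imm_right (P := (Edc.pullback f g).toEventStructure) h.1 hne
    have himm := pullback_imm_image hf hg hc (Or.inr hp)
    have hcV : c.top.img ∈ V := (hR.mem_visible_iff himm.1).2 p'.2
    rcases h.2.2 ⟨c, hcV⟩ hpc hc.1 with hcp | hcp
    · rw [← hcp]; exact himm
    · exact absurd (congrArg Subtype.val hcp) hc.2.1

theorem pbEquiv_iff (hR : IsArena R V U W) (hf : IsComponent f V U W)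
    (hg : IsComponent g V W U) {d d' : PbEvent f g} : PbEquiv d d' ↔ d.img = d'.img := by
  refine ⟨fun h => hR.equiv_eq (f.map_equiv h.1), fun h => ⟨hf.saturated h, hg.saturated ?_⟩⟩
  rwa [← PbEvent.img_eq, ← PbEvent.img_eq]

/-- The events strictly below a move of the environment are determined by the visible ones. -/
theorem carrier_diff_top_subset (hR : IsArena R V U W) (hf : IsComponent f V U W)
    (hg : IsComponent g V W U) {p p' : visibleEvents f g V}
    (h : (hiddenPullback f g V).strictBelow p ⊆ (hiddenPullback f g V).strictBelow p')
    (hp : p.1.top.img ∉ U ∪ W) : p.1.carrier \ {p.1.top} ⊆ p'.1.carrier \ {p'.1.top} := by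
  rintro d ⟨hd, hdt⟩
  obtain ⟨q, hq, rfl⟩ := p.1.exists_sub hd
  have hne : q ≠ p.1 := by rintro rfl; exact hdt rfl
  obtain ⟨c, hqc, hc⟩ :=
    EventStructure.exists_imm_right (P := (Edc.pullback f g).toEventStructure) hq hne
  have himm := pullback_imm_image hf hg hc (Or.inr hp)
  have hcV : c.top.img ∈ V := (hR.mem_visible_iff himm.1).2 p.2
  have hcp' := @h ⟨c, hcV⟩ ⟨hc.1, fun h' => hc.2.1 (congrArg Subtype.val h')⟩
  have hle : c.carrier ⊆ p'.1.carrier := hcp'.1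
  refine ⟨hle (hqc q.top_mem), fun ht => hcp'.2 (Subtype.ext ?_)⟩
  exact StableFamily.Prime.eq_of_top_mem hle (Set.mem_singleton_iff.1 ht ▸ hqc q.top_mem)

theorem strictBelow_top_fst_subset {p : (pbFamily f g).Prime} :
    P.strictBelow p.top.fst ⊆ PbEvent.fst '' (p.carrier \ {p.top}) := by
  rintro e ⟨he, hne⟩
  obtain ⟨d, hd, rfl⟩ := (show PbStableConfig _ from p.mem).1.1.1.2 _ ⟨_, p.top_mem, rfl⟩ _ he
  exact ⟨d, ⟨hd, by rintro rfl; exact hne rfl⟩, rfl⟩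

theorem strictBelow_top_snd_subset {p : (pbFamily f g).Prime} :
    Q.strictBelow p.top.snd ⊆ PbEvent.snd '' (p.carrier \ {p.top}) := by
  rintro e ⟨he, hne⟩
  obtain ⟨d, hd, rfl⟩ := (show PbStableConfig _ from p.mem).1.1.2.2 _ ⟨_, p.top_mem, rfl⟩ _ he
  exact ⟨d, ⟨hd, by rintro rfl; exact hne rfl⟩, rfl⟩

theorem hiddenPullback_nonRedundant (hR : IsArena R V U W) (hf : IsComponent f V U W)
    (hg : IsComponent g V W U) {p p' : visibleEvents f g V}
    (h : (hiddenPullback f g V).strictBelow p = (hiddenPullback f g V).strictBelow p')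
    (himg : p.1.top.img = p'.1.top.img) (hp : p.1.top.img ∉ U ∪ W) : p = p' := by
  have hx : p.1.carrier \ {p.1.top} = p'.1.carrier \ {p'.1.top} :=
    (carrier_diff_top_subset hR hf hg h.le hp).antisymm
      (carrier_diff_top_subset hR hf hg h.ge (himg ▸ hp))
  have hm : PbMatching p.1.carrier := (show PbStableConfig _ from p.1.mem).1.1
  have hu : ∀ d ∈ p.1.carrier \ {p.1.top}, ∀ d' ∈ p.1.carrier \ {p.1.top},
      d.img = d'.img → d = d' :=
    fun d hd d' hd' h => p.1.unambiguous d hd.1 d' hd'.1 ((pbEquiv_iff hR hf hg).2 h)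
  have h1 : p.1.top.fst = p'.1.top.fst := by
    refine hf.eq_of_image_eq (x := PbEvent.fst '' (p.1.carrier \ {p.1.top}))
      ?_ ?_ ?_ himg fun h => hp (Or.inl h)
    · rintro _ ⟨d, hd, rfl⟩ _ ⟨d', hd', rfl⟩ h
      rw [hu d hd d' hd' h]
    · exact strictBelow_top_fst_subset
    · rw [hx]; exact strictBelow_top_fst_subset
  have h2 : p.1.top.snd = p'.1.top.snd := by
    rw [PbEvent.img_eq] at himg hp
    rw [PbEvent.img_eq] at himg
    refine hg.eq_of_image_eq (x := PbEvent.snd '' (p.1.carrier \ {p.1.top}))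
      ?_ ?_ ?_ himg fun h => hp (Or.inr h)
    · rintro _ ⟨d, hd, rfl⟩ _ ⟨d', hd', rfl⟩ h
      rw [← PbEvent.img_eq, ← PbEvent.img_eq] at h
      rw [hu d hd d' hd' h]
    · exact strictBelow_top_snd_subset
    · rw [hx]; exact strictBelow_top_snd_subset
  have ht := PbEvent.ext' h1 h2
  refine Subtype.ext (StableFamily.Prime.ext' ?_)
  rw [← Set.insert_sdiff_self_of_mem p.1.top_mem, ← Set.insert_sdiff_self_of_mem p'.1.top_mem,
    hx, ht]

end Pullback

section Pullback

variable {E F G : Type*} {P : Edc E} {Q : Edc F} {R : Edc G} {f : EdcMap P R} {g : EdcMap Q R}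
  {V U W : Set G}

/-! ### Unions of configurations of the pullback -/

/-- Unions of configurations of the pullback, without any requirement of consistency. -/
def PbUnion (z : Set (PbEvent f g)) : Prop := ∀ d ∈ z, ∃ w, PbStableConfig w ∧ d ∈ w ∧ w ⊆ z

theorem PbStableConfig.pbUnion {z : Set (PbEvent f g)} (hz : PbStableConfig z) : PbUnion z :=
  fun _ hd => ⟨z, hz, hd, subset_rfl⟩

theorem PbUnion.biUnion {ι : Type*} {s : Set ι} {z : ι → Set (PbEvent f g)}
    (h : ∀ i ∈ s, PbUnion (z i)) : PbUnion (⋃ i ∈ s, z i) := by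
  intro d hd
  obtain ⟨i, hi, hd⟩ := Set.mem_iUnion₂.1 hd
  obtain ⟨w, hw, hdw, hwz⟩ := h i hi d hd
  exact ⟨w, hw, hdw, hwz.trans (Set.subset_biUnion_of_mem (u := z) hi)⟩

theorem PbUnion.union {y z : Set (PbEvent f g)} (hy : PbUnion y) (hz : PbUnion z) :
    PbUnion (y ∪ z) := by
  rintro d (hd | hd)
  · obtain ⟨w, hw, hdw, h⟩ := hy d hd
    exact ⟨w, hw, hdw, h.trans Set.subset_union_left⟩
  · obtain ⟨w, hw, hdw, h⟩ := hz d hd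
    exact ⟨w, hw, hdw, h.trans Set.subset_union_right⟩

theorem PbUnion.fst_downClosed {z : Set (PbEvent f g)} (hz : PbUnion z) :
    ∀ e ∈ PbEvent.fst '' z, ∀ e', P.le e' e → e' ∈ PbEvent.fst '' z := by
  rintro _ ⟨d, hd, rfl⟩ e' he'
  obtain ⟨w, hw, hdw, hwz⟩ := hz d hd
  exact Set.image_mono hwz (hw.1.1.1.2 _ ⟨d, hdw, rfl⟩ _ he')

theorem PbUnion.snd_downClosed {z : Set (PbEvent f g)} (hz : PbUnion z) :
    ∀ e ∈ PbEvent.snd '' z, ∀ e', Q.le e' e → e' ∈ PbEvent.snd '' z := by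
  rintro _ ⟨d, hd, rfl⟩ e' he'
  obtain ⟨w, hw, hdw, hwz⟩ := hz d hd
  exact Set.image_mono hwz (hw.1.1.2.2 _ ⟨d, hdw, rfl⟩ _ he')

theorem PbUnion.stableConfig_of_subset {y z : Set (PbEvent f g)} (hy : PbUnion y)
    (hz : PbStableConfig z) (h : y ⊆ z) : PbStableConfig y :=
  StableFamily.mem_of_forall_mem (𝓕 := pbFamily f g) hz h hy

/-- A union of configurations of the pullback is a configuration as soon as both its projections
are consistent. -/
theorem PbUnion.stableConfig {z : Set (PbEvent f g)} (hz : PbUnion z)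
    (h₁ : PbEvent.fst '' z ∈ P.Con) (h₂ : PbEvent.snd '' z ∈ Q.Con) : PbStableConfig z := by
  refine ⟨⟨⟨(EventStructure.isFinConfig_of_mem_con h₁ hz.fst_downClosed).1,
    (EventStructure.isFinConfig_of_mem_con h₂ hz.snd_downClosed).1⟩, fun d hd => ?_⟩,
    fun d hd => ?_⟩
  · obtain ⟨w, hw, hdw, hwz⟩ := hz d hd
    obtain ⟨l, hl, hp⟩ := hw.1.2 d hdw
    exact ⟨l, fun e he => hwz (hl e he), hp⟩
  · obtain ⟨w, hw, hdw, hwz⟩ := hz d hd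
    obtain ⟨x, hx, hu, hdx, hxw⟩ := hw.2 d hdw
    exact ⟨x, hx, hu, hdx, hxw.trans hwz⟩

theorem PbStableConfig.fst_isFinConfig {z : Set (PbEvent f g)} (hz : PbStableConfig z)
    (hf : z.Finite) : P.IsFinConfig (PbEvent.fst '' z) := ⟨hz.1.1.1, hf.image _⟩

theorem PbStableConfig.snd_isFinConfig {z : Set (PbEvent f g)} (hz : PbStableConfig z)
    (hf : z.Finite) : Q.IsFinConfig (PbEvent.snd '' z) := ⟨hz.1.1.2, hf.image _⟩

theorem List.exists_prefix_append_singleton {D : Type*} (y : Set D) (l : List D)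
    (h : ∃ d ∈ l, d ∉ y) : ∃ l' d, l' ++ [d] <+: l ∧ (∀ e ∈ l', e ∈ y) ∧ d ∉ y := by
  induction l with
  | nil => simp at h
  | cons a l ih =>
    by_cases ha : a ∈ y
    · obtain ⟨d, hd, hdy⟩ := h
      have hdl : d ∈ l := (List.mem_cons.1 hd).resolve_left (by rintro rfl; exact hdy ha)
      obtain ⟨l', d', hp, hl', hd'⟩ := ih ⟨d, hdl, hdy⟩
      exact ⟨a :: l', d', by simpa using hp, by simpa [ha] using hl', hd'⟩
    · exact ⟨[], a, by simp, by simp, ha⟩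

theorem PbUnion.exists_insert {y z : Set (PbEvent f g)} (hy : PbUnion y) (hz : PbUnion z)
    (h : (z \ y).Nonempty) : ∃ d ∈ z, d ∉ y ∧ PbUnion (insert d y) := by
  obtain ⟨d₀, hd₀, hd₀y⟩ := h
  obtain ⟨w, hw, hdw, hwz⟩ := hz d₀ hd₀
  obtain ⟨l, hl, hp⟩ := (pbFamily f g).secured w hw d₀ hdw
  obtain ⟨l', d, hpre, hl', hd⟩ := List.exists_prefix_append_singleton y (l ++ [d₀])
    ⟨d₀, by simp, hd₀y⟩
  refine ⟨d, hwz ?_, hd, ?_⟩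
  · have : d ∈ l ++ [d₀] := hpre.subset (by simp)
    rcases List.mem_append.1 this with h | h
    · exact hl _ h
    · rw [List.mem_singleton.1 h]; exact hdw
  · have hw' : PbStableConfig {e | e ∈ l' ++ [d]} := hp _ hpre
    have := hy.union hw'.pbUnion
    rwa [show y ∪ {e | e ∈ l' ++ [d]} = insert d y from ?_] at this
    ext e
    simp only [List.mem_append, List.mem_singleton, Set.mem_union, Set.mem_ofPred_eq,
      Set.mem_insert_iff]
    have := hl' e
    tauto

/-- The events of the pullback which occur in a set of visible prime configurations. -/
def eventsOf (x : Set (visibleEvents f g V)) : Set (PbEvent f g) := ⋃ p ∈ x, p.1.carrier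

theorem eventsOf_finite {x : Set (visibleEvents f g V)} (hx : x.Finite) : (eventsOf x).Finite :=
  hx.biUnion fun p _ => p.1.finite

theorem eventsOf_pbUnion (x : Set (visibleEvents f g V)) : PbUnion (eventsOf x) :=
  PbUnion.biUnion fun p _ => PbStableConfig.pbUnion p.1.mem

theorem mem_hiddenPullback_con {x : Set (visibleEvents f g V)} :
    x ∈ (hiddenPullback f g V).Con ↔ x.Finite ∧ PbStableConfig (eventsOf x) := by
  have h : ⋃ p ∈ (Subtype.val '' x : Set (pbFamily f g).Prime), p.carrier = eventsOf x :=
    Set.biUnion_image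
  have hc : x ∈ (hiddenPullback f g V).Con ↔ (Subtype.val '' x).Finite ∧
      PbStableConfig (⋃ p ∈ (Subtype.val '' x : Set (pbFamily f g).Prime), p.carrier) := Iff.rfl
  rw [hc, h, Set.finite_image_iff Subtype.val_injective.injOn]

/-- The events of the pullback below `x` played by one of the strategies are below the visible
events of `x` played by one of the strategies. -/
theorem mem_eventsOf_of_mem (hR : IsArena R V U W) (hf : IsComponent f V U W)
    (hg : IsComponent g V W U) {x y : Set (visibleEvents f g V)}
    (h : ∀ p ∈ (hiddenPullback f g V).down x, p.1.top.img ∈ U ∪ W → p ∈ y) {d : PbEvent f g}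
    (hd : d ∈ eventsOf x) (hdU : d.img ∈ U ∪ W) : d ∈ eventsOf y := by
  obtain ⟨p, hp, hd⟩ := Set.mem_iUnion₂.1 hd
  obtain ⟨q, hq, rfl⟩ := p.1.exists_sub hd
  obtain ⟨r, hqr, hrp, hrV, hrU⟩ := exists_visible_between hR hf hg hq p.2 hdU
  exact Set.mem_biUnion (t := fun p : visibleEvents f g V => p.1.carrier)
    (h ⟨r, hrV⟩ ⟨p, hp, hrp⟩ hrU) (hqr q.top_mem)

theorem hiddenPullback_plusConsistent (hR : IsArena R V U W) (hf : IsComponent f V U W)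
    (hg : IsComponent g V W U) {X : Set (visibleEvents f g V)} (hX : X.Finite)
    (himg : (fun p : visibleEvents f g V => p.1.top.img) '' (hiddenPullback f g V).down X ∈ R.Con)
    (hplus : {p ∈ (hiddenPullback f g V).down X | p.1.top.img ∈ U ∪ W} ∈
      (hiddenPullback f g V).Con) : X ∈ (hiddenPullback f g V).Con := by
  rw [mem_hiddenPullback_con] at hplus ⊢
  have hz := eventsOf_finite hX
  have hsub : ∀ d ∈ eventsOf X, d.img ∈ U ∪ W →
      d ∈ eventsOf {p ∈ (hiddenPullback f g V).down X | p.1.top.img ∈ U ∪ W} :=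
    fun d hd hdU => mem_eventsOf_of_mem hR hf hg (fun _ hp hpU => Set.mem_sep hp hpU) hd hdU
  have h₁ := hplus.2.fst_isFinConfig (eventsOf_finite hplus.1)
  have h₂ := hplus.2.snd_isFinConfig (eventsOf_finite hplus.1)
  have hcon : PbEvent.img '' eventsOf X ∈ R.Con := by
    refine hR.con (R.con_mono ?_ himg) (R.con_mono ?_ (f.map_config h₁).mem_con)
    · rintro _ ⟨⟨d, hd, rfl⟩, hdV⟩
      obtain ⟨p, hp, hd⟩ := Set.mem_iUnion₂.1 hd
      obtain ⟨q, hq, rfl⟩ := p.1.exists_sub hd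
      exact ⟨⟨q, hdV⟩, ⟨p, hp, hq⟩, rfl⟩
    · rintro _ ⟨⟨d, hd, rfl⟩, hdV⟩
      exact ⟨_, ⟨d, hsub d hd (hR.hidden hdV), rfl⟩, rfl⟩
  have hU := eventsOf_pbUnion X
  refine ⟨hX, hU.stableConfig (hf.plusConsistent (hz.image _) hU.fst_downClosed ?_ ?_)
    (hg.plusConsistent (hz.image _) hU.snd_downClosed ?_ ?_)⟩
  · rwa [Set.image_image]
  · refine P.con_mono ?_ h₁.mem_con
    rintro _ ⟨⟨d, hd, rfl⟩, hdU⟩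
    exact ⟨d, hsub d hd (Or.inl hdU), rfl⟩
  · rw [Set.image_image]
    simpa only [← PbEvent.img_eq] using hcon
  · refine Q.con_mono ?_ h₂.mem_con
    rintro _ ⟨⟨d, hd, rfl⟩, hdU⟩
    exact ⟨d, hsub d hd (Or.inr (d.img_eq ▸ hdU)), rfl⟩

end Pullback

/-! ### Configuration-valuations extended by zero -/

open Classical in
/-- The extension by zero of `v` to all sets of events. -/
noncomputable def EventStructure.extendZero {E : Type*} (P : EventStructure E) (v : Set E → ℝ)
    (x : Set E) : ℝ :=
  if P.IsFinConfig x then v x else 0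

theorem EdcPol.drop_eq_altSum {E : Type*} {P : EdcPol E} (v : Set E → ℝ) {y : Set E} {n : ℕ}
    {x : Fin n → Set E} (hy : P.IsFinConfig y) (hx : ∀ i, y ⊆ x i) :
    P.drop v y x = altSum Finset.univ fun K => P.extendZero v (y ∪ ⋃ i ∈ K, x i) := by
  rw [EdcPol.drop, altSum, Finset.powerset_univ, sub_eq_iff_eq_add, Finset.sum_filter,
    ← Finset.sum_add_distrib, Finset.sum_eq_single ∅]
  · simp [EventStructure.extendZero, hy]
  · intro K _ hK
    have hK := Finset.nonempty_iff_ne_empty.2 hK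
    obtain ⟨i, hi⟩ := hK
    have hu : y ∪ ⋃ i ∈ K, x i = ⋃ i ∈ K, x i := Set.union_eq_right.2
      ((hx i).trans (Set.subset_biUnion_of_mem (u := x) (s := (K : Set (Fin n))) hi))
    rw [hu, EventStructure.extendZero]
    by_cases hc : P.IsFinConfig (⋃ i ∈ K, x i)
    · rw [if_pos hc, if_pos ⟨⟨i, hi⟩, hc⟩, pow_succ]
      ring
    · rw [if_neg hc, if_neg fun h => hc h.2]
      simp
  · simp

/-- A configuration-valuation extended by zero, for `O` the set of Player moves. -/
structure IsExtendedValuation {E : Type*} (P : EventStructure E) (O : Set E) (v : Set E → ℝ) :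
    Prop where
  eq_zero : ∀ {x}, ¬ P.IsFinConfig x → v x = 0
  lmc : ∀ {x y}, P.IsFinConfig x → P.IsFinConfig y → x ⊆ y → (∀ e ∈ y, e ∉ x → e ∉ O) → v x = v y
  drop_nonneg : ∀ {y : Set E} {n : ℕ} {x : Fin n → Set E}, P.IsFinConfig y →
    (∀ i, P.IsFinConfig (x i)) → (∀ i, y ⊆ x i) → (∀ i, ∀ e ∈ x i, e ∉ y → e ∈ O) →
    0 ≤ altSum Finset.univ fun K => v (y ∪ ⋃ i ∈ K, x i)

theorem union_biUnion_congr {ι D : Type*} {y : Set D} {s : Set ι} {x x' : ι → Set D}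
    (h : ∀ i ∈ s, y ∪ x i = y ∪ x' i) : y ∪ ⋃ i ∈ s, x i = y ∪ ⋃ i ∈ s, x' i := by
  ext e
  have h' := fun i hi => Set.ext_iff.1 (h i hi) e
  simp only [Set.mem_union, Set.mem_iUnion] at h' ⊢
  constructor
  · rintro (he | ⟨i, hi, he⟩)
    · exact Or.inl he
    · exact ((h' i hi).1 (Or.inr he)).imp_right fun h => ⟨i, hi, h⟩
  · rintro (he | ⟨i, hi, he⟩)
    · exact Or.inl he
    · exact ((h' i hi).2 (Or.inr he)).imp_right fun h => ⟨i, hi, h⟩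

/-- Nonnegativity of drops for arbitrary finite index sets and for extensions which need not be
consistent: inconsistent ones contribute nothing. -/
theorem IsExtendedValuation.altSum_nonneg {E ι : Type*} {P : EventStructure E} {O : Set E}
    {v : Set E → ℝ} (hv : IsExtendedValuation P O v) {s : Finset ι} {y : Set E} {x : ι → Set E}
    (hy : P.IsFinConfig y) (hd : ∀ i ∈ s, ∀ e ∈ y ∪ x i, ∀ e', P.le e' e → e' ∈ y ∪ x i)
    (hO : ∀ i ∈ s, ∀ e ∈ x i, e ∉ y → e ∈ O) :
    0 ≤ altSum s fun K => v (y ∪ ⋃ i ∈ K, x i) := by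
  classical
  have hs : altSum s (fun K => v (y ∪ ⋃ i ∈ K, x i)) =
      altSum (s.filter fun i => P.IsFinConfig (y ∪ x i)) fun K => v (y ∪ ⋃ i ∈ K, x i) := by
    refine (Finset.sum_subset (Finset.powerset_mono.2 (Finset.filter_subset _ s)) ?_).symm
    intro K hK hn
    refine mul_eq_zero_of_right _ (hv.eq_zero fun hc => ?_)
    refine hn (Finset.mem_powerset.2 fun i hi => Finset.mem_filter.2 ⟨Finset.mem_powerset.1 hK hi,
      hc.of_subset (Set.union_subset_union_right _ ?_) (hd i (Finset.mem_powerset.1 hK hi))⟩)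
    exact Set.subset_biUnion_of_mem (u := x) (s := (K : Set ι)) hi
  rw [hs]
  set t := s.filter fun i => P.IsFinConfig (y ∪ x i) with ht
  let e : Fin t.card ↪ ι := t.equivFin.symm.toEmbedding.trans (Function.Embedding.subtype _)
  have he : Finset.univ.map e = t := by
    ext i
    simp only [Finset.mem_map, Finset.mem_univ, true_and]
    exact ⟨by rintro ⟨j, rfl⟩; exact (t.equivFin.symm j).2,
      fun hi => ⟨t.equivFin ⟨i, hi⟩, by simp [e]⟩⟩
  have hmem : ∀ j, e j ∈ t := fun j => (t.equivFin.symm j).2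
  rw [← he, altSum_map]
  have := hv.drop_nonneg (x := fun j => y ∪ x (e j)) hy
    (fun j => (Finset.mem_filter.1 (hmem j)).2) (fun _ => Set.subset_union_left)
    fun j a ha hay => hO _ (Finset.mem_filter.1 (hmem j)).1 a (ha.resolve_left hay) hay
  convert this using 3 with K
  rw [show ⋃ i ∈ K.map e, x i = ⋃ j ∈ K, x (e j) by ext a; simp]
  congr 1
  exact union_biUnion_congr (s := (K : Set (Fin t.card))) fun j _ => by
    rw [← Set.union_assoc, Set.union_self]

section Pullback

variable {E F G : Type*} {P : Edc E} {Q : Edc F} {R : Edc G} {f : EdcMap P R} {g : EdcMap Q R}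
  {V U W : Set G}

/-! ### Drops of the product of two valuations -/

open Classical in
/-- The product of two valuations on the configurations of the pullback, extended by zero. -/
noncomputable def pbVal (v : Set E → ℝ) (w : Set F → ℝ) (z : Set (PbEvent f g)) : ℝ :=
  if PbStableConfig z then v (PbEvent.fst '' z) * w (PbEvent.snd '' z) else 0

/-- If the first strategy extends `y` to `z₁` and the second one extends it to `z₂`, then `z₁ ∪ z₂`
is a configuration as soon as the projection of `z₁` to the first strategy and that of `z₂` to the
second are: the images are compatible by race-freeness, and the moves in `z₂ \ y` are Opponent
moves for the first strategy, so they cannot destroy consistency there. -/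
theorem PbUnion.stableConfig_union (hR : IsArena R V U W) (hf : IsComponent f V U W)
    (hg : IsComponent g V W U) {y z₁ z₂ : Set (PbEvent f g)} (hy : PbStableConfig y)
    (h₁ : PbUnion z₁) (h₂ : PbUnion z₂) (hyz₁ : y ⊆ z₁) (hyz₂ : y ⊆ z₂)
    (hU : ∀ d ∈ z₁, d ∉ y → d.img ∈ U) (hW : ∀ d ∈ z₂, d ∉ y → d.img ∈ W)
    (hc₁ : P.IsFinConfig (PbEvent.fst '' z₁)) (hc₂ : Q.IsFinConfig (PbEvent.snd '' z₂))
    (hfin : (z₁ ∪ z₂).Finite) : PbStableConfig (z₁ ∪ z₂) := by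
  have hyfin : y.Finite := hfin.subset (hyz₁.trans Set.subset_union_left)
  have i₀ : R.IsFinConfig (PbEvent.img '' y) := by
    have := f.map_config (hy.fst_isFinConfig hyfin)
    rwa [Set.image_image] at this
  have i₁ : R.IsFinConfig (PbEvent.img '' z₁) := by
    have := f.map_config hc₁
    rwa [Set.image_image] at this
  have i₂ : R.IsFinConfig (PbEvent.img '' z₂) := by
    have := g.map_config hc₂
    rw [Set.image_image] at this
    simpa only [← PbEvent.img_eq] using this
  have hi : R.IsFinConfig (PbEvent.img '' (z₁ ∪ z₂)) := by
    rw [Set.image_union]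
    refine hR.union i₀ i₁ i₂ (Set.image_mono hyz₁) (Set.image_mono hyz₂) ?_ ?_
    · rintro _ ⟨⟨d, hd, rfl⟩, hn⟩
      exact hU d hd fun h => hn ⟨d, h, rfl⟩
    · rintro _ ⟨⟨d, hd, rfl⟩, hn⟩
      exact hW d hd fun h => hn ⟨d, h, rfl⟩
  have hu := h₁.union h₂
  refine hu.stableConfig (hf.plusConsistent (hfin.image _) hu.fst_downClosed ?_ ?_)
    (hg.plusConsistent (hfin.image _) hu.snd_downClosed ?_ ?_)
  · rw [Set.image_image]
    exact hi.mem_con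
  · refine P.con_mono ?_ hc₁.mem_con
    rintro _ ⟨⟨d, hd | hd, rfl⟩, hdU⟩
    · exact ⟨d, hd, rfl⟩
    · refine ⟨d, hyz₁ ?_, rfl⟩
      by_contra hn
      exact hR.disjoint hdU (hW d hd hn)
  · rw [Set.image_image]
    simpa only [← PbEvent.img_eq] using hi.mem_con
  · refine Q.con_mono ?_ hc₂.mem_con
    rintro _ ⟨⟨d, hd | hd, rfl⟩, hdU⟩
    · refine ⟨d, hyz₂ ?_, rfl⟩
      by_contra hn
      exact hR.disjoint (hU d hd hn) (d.img_eq ▸ hdU)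
    · exact ⟨d, hd, rfl⟩

theorem pbVal_union (hR : IsArena R V U W) (hf : IsComponent f V U W)
    (hg : IsComponent g V W U) {v : Set E → ℝ} {w : Set F → ℝ}
    (hv : IsExtendedValuation P.toEventStructure (f.toFun ⁻¹' U) v)
    (hw : IsExtendedValuation Q.toEventStructure (g.toFun ⁻¹' W) w)
    {y z₁ z₂ : Set (PbEvent f g)} (hy : PbStableConfig y)
    (h₁ : PbUnion z₁) (h₂ : PbUnion z₂) (hyz₁ : y ⊆ z₁) (hyz₂ : y ⊆ z₂)
    (hU : ∀ d ∈ z₁, d ∉ y → d.img ∈ U) (hW : ∀ d ∈ z₂, d ∉ y → d.img ∈ W)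
    (hfin : (z₁ ∪ z₂).Finite) :
    pbVal v w (z₁ ∪ z₂) = v (PbEvent.fst '' z₁) * w (PbEvent.snd '' z₂) := by
  have hf₁ := hfin.subset Set.subset_union_left
  have hf₂ := hfin.subset Set.subset_union_right
  by_cases hz : PbStableConfig (z₁ ∪ z₂)
  · rw [pbVal, if_pos hz]
    have c₁ := (h₁.stableConfig_of_subset hz Set.subset_union_left).fst_isFinConfig hf₁
    have c₂ := (h₂.stableConfig_of_subset hz Set.subset_union_right).snd_isFinConfig hf₂
    congr 1
    · refine (hv.lmc c₁ (hz.fst_isFinConfig hfin) (Set.image_mono Set.subset_union_left) ?_).symm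
      rintro _ ⟨d, hd | hd, rfl⟩ hn hdU
      · exact hn ⟨d, hd, rfl⟩
      · exact hR.disjoint hdU (hW d hd fun h => hn ⟨d, hyz₁ h, rfl⟩)
    · refine (hw.lmc c₂ (hz.snd_isFinConfig hfin) (Set.image_mono Set.subset_union_right) ?_).symm
      rintro _ ⟨d, hd | hd, rfl⟩ hn hdW
      · exact hR.disjoint (hU d hd fun h => hn ⟨d, hyz₂ h, rfl⟩) (d.img_eq ▸ hdW)
      · exact hn ⟨d, hd, rfl⟩
  · rw [pbVal, if_neg hz]
    by_cases c₁ : P.IsFinConfig (PbEvent.fst '' z₁)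
    · by_cases c₂ : Q.IsFinConfig (PbEvent.snd '' z₂)
      · exact absurd (PbUnion.stableConfig_union hR hf hg hy h₁ h₂ hyz₁ hyz₂ hU hW c₁ c₂ hfin) hz
      · rw [hw.eq_zero c₂, mul_zero]
    · rw [hv.eq_zero c₁, zero_mul]

theorem biUnion_filter_union {ι D : Type*} (p : ι → Prop) [DecidablePred p] (K : Finset ι)
    (y : Set D) (x : ι → Set D) : y ∪ ⋃ i ∈ K, x i =
      (y ∪ ⋃ i ∈ K.filter p, x i) ∪ (y ∪ ⋃ i ∈ K.filter (fun i => ¬ p i), x i) := by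
  ext e
  simp only [Set.mem_union, Set.mem_iUnion, Finset.mem_filter, exists_prop]
  constructor
  · rintro (h | ⟨i, hi, he⟩)
    · exact Or.inl (Or.inl h)
    · by_cases hp : p i
      · exact Or.inl (Or.inr ⟨i, ⟨hi, hp⟩, he⟩)
      · exact Or.inr (Or.inr ⟨i, ⟨hi, hp⟩, he⟩)
  · rintro ((h | ⟨i, hi, he⟩) | (h | ⟨i, hi, he⟩))
    · exact Or.inl h
    · exact Or.inr ⟨i, hi.1, he⟩
    · exact Or.inl h
    · exact Or.inr ⟨i, hi.1, he⟩

theorem PbUnion.union_biUnion {ι : Type*} {y : Set (PbEvent f g)} {x : ι → Set (PbEvent f g)}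
    (hy : PbUnion y) {K : Finset ι} (hx : ∀ i ∈ K, PbUnion (y ∪ x i)) :
    PbUnion (y ∪ ⋃ i ∈ K, x i) := by
  have h := hy.union (PbUnion.biUnion (s := (K : Set ι)) hx)
  have h' := union_biUnion_congr (y := y) (s := (K : Set ι)) (x := fun i => y ∪ x i) (x' := x)
    fun i _ => by rw [← Set.union_assoc, Set.union_self]
  rw [h'] at h
  exact h

/-- When each extension of `y` is due to one of the two strategies alone, the drop of the product
is the product of the drops. -/
theorem pbVal_altSum_nonneg_of_forall (hR : IsArena R V U W) (hf : IsComponent f V U W)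
    (hg : IsComponent g V W U) {v : Set E → ℝ} {w : Set F → ℝ}
    (hv : IsExtendedValuation P.toEventStructure (f.toFun ⁻¹' U) v)
    (hw : IsExtendedValuation Q.toEventStructure (g.toFun ⁻¹' W) w)
    {ι : Type*} {s : Finset ι} {y : Set (PbEvent f g)} {x : ι → Set (PbEvent f g)}
    (hy : PbStableConfig y) (hyfin : y.Finite) (hx : ∀ i ∈ s, PbUnion (y ∪ x i))
    (hxfin : ∀ i ∈ s, (x i).Finite)
    (hUW : ∀ i ∈ s, (∀ d ∈ x i, d ∉ y → d.img ∈ U) ∨ (∀ d ∈ x i, d ∉ y → d.img ∈ W)) :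
    0 ≤ altSum s fun K => pbVal v w (y ∪ ⋃ i ∈ K, x i) := by
  classical
  let p : ι → Prop := fun i => ∀ d ∈ x i, d ∉ y → d.img ∈ U
  rw [altSum_mul p s (a := fun K => v (PbEvent.fst '' (y ∪ ⋃ i ∈ K, x i)))
    (b := fun K => w (PbEvent.snd '' (y ∪ ⋃ i ∈ K, x i)))]
  · refine mul_nonneg ?_ ?_
    · simp_rw [Set.image_union, Set.image_iUnion₂]
      refine hv.altSum_nonneg (hy.fst_isFinConfig hyfin) ?_ ?_
      · intro i hi
        rw [← Set.image_union]
        exact (hx i (Finset.mem_filter.1 hi).1).fst_downClosed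
      · rintro i hi _ ⟨d, hd, rfl⟩ hn
        exact (Finset.mem_filter.1 hi).2 d hd fun h => hn ⟨d, h, rfl⟩
    · simp_rw [Set.image_union, Set.image_iUnion₂]
      refine hw.altSum_nonneg (hy.snd_isFinConfig hyfin) ?_ ?_
      · intro i hi
        rw [← Set.image_union]
        exact (hx i (Finset.mem_filter.1 hi).1).snd_downClosed
      · rintro i hi _ ⟨d, hd, rfl⟩ hn
        have hi' := Finset.mem_filter.1 hi
        have := (hUW i hi'.1).resolve_left hi'.2 d hd fun h => hn ⟨d, h, rfl⟩
        rwa [PbEvent.img_eq] at this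
  · intro K hK
    have hfin : (y ∪ ⋃ i ∈ K, x i).Finite :=
      hyfin.union (K.finite_toSet.biUnion fun i hi => hxfin i (hK hi))
    rw [biUnion_filter_union p] at hfin ⊢
    refine pbVal_union hR hf hg hv hw hy
      (hy.pbUnion.union_biUnion fun i hi => hx i (hK (Finset.mem_filter.1 hi).1))
      (hy.pbUnion.union_biUnion fun i hi => hx i (hK (Finset.mem_filter.1 hi).1))
      Set.subset_union_left Set.subset_union_left ?_ ?_ hfin
    · rintro d (hd | hd) hn
      · exact absurd hd hn
      · obtain ⟨i, hi, hd⟩ := Set.mem_iUnion₂.1 hd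
        exact (Finset.mem_filter.1 hi).2 d hd hn
    · rintro d (hd | hd) hn
      · exact absurd hd hn
      · obtain ⟨i, hi, hd⟩ := Set.mem_iUnion₂.1 hd
        have hi' := Finset.mem_filter.1 hi
        exact (hUW i (hK hi'.1)).resolve_left hi'.2 d hd hn

/-- Splitting an extension into a first part `a` and the rest splits the drop in two: the drop for
`a` in place of the extension, and the drop after `a` has been added to the base. -/
theorem altSum_split {ι D : Type*} [DecidableEq ι] (φ : Set D → ℝ) {s : Finset ι} {i : ι}
    (hi : i ∈ s) (y : Set D) (x : ι → Set D) {a : Set D} (ha : a ⊆ x i) :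
    altSum s (fun K => φ (y ∪ ⋃ j ∈ K, x j)) =
      altSum s (fun K => φ (y ∪ ⋃ j ∈ K, Function.update x i a j)) +
        altSum s (fun K => φ (y ∪ a ∪ ⋃ j ∈ K, x j)) := by
  rw [← Finset.insert_erase hi]
  have hi' := Finset.notMem_erase i s
  rw [altSum_insert hi', altSum_insert hi', altSum_insert hi']
  have h₁ : ∀ K ⊆ s.erase i, ⋃ j ∈ K, Function.update x i a j = ⋃ j ∈ K, x j := fun K hK =>
    Set.iUnion₂_congr fun j hj => by
      rw [Function.update_of_ne]
      rintro rfl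
      exact hi' (hK hj)
  have e₁ : altSum (s.erase i) (fun K => φ (y ∪ ⋃ j ∈ K, Function.update x i a j)) =
      altSum (s.erase i) (fun K => φ (y ∪ ⋃ j ∈ K, x j)) :=
    altSum_congr fun K hK => by rw [h₁ K hK]
  have e₂ : altSum (s.erase i) (fun K => φ (y ∪ ⋃ j ∈ insert i K, Function.update x i a j)) =
      altSum (s.erase i) (fun K => φ (y ∪ a ∪ ⋃ j ∈ K, x j)) :=
    altSum_congr fun K hK => by
      rw [Finset.set_biUnion_insert, h₁ K hK, Function.update_self, Set.union_assoc]
  have e₃ : altSum (s.erase i) (fun K => φ (y ∪ a ∪ ⋃ j ∈ insert i K, x j)) =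
      altSum (s.erase i) (fun K => φ (y ∪ ⋃ j ∈ insert i K, x j)) :=
    altSum_congr fun K hK => by
      rw [Finset.set_biUnion_insert, Set.union_assoc, ← Set.union_assoc a, Set.union_eq_right.2 ha]
  rw [e₁, e₂, e₃]
  ring

/-- The drop of the product across any extensions by moves of the two strategies is nonnegative. It
is a sum of drops across extensions by single moves, each of which is due to one strategy alone. -/
theorem pbVal_altSum_nonneg (hR : IsArena R V U W) (hf : IsComponent f V U W)
    (hg : IsComponent g V W U) {v : Set E → ℝ} {w : Set F → ℝ}
    (hv : IsExtendedValuation P.toEventStructure (f.toFun ⁻¹' U) v)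
    (hw : IsExtendedValuation Q.toEventStructure (g.toFun ⁻¹' W) w)
    {ι : Type*} {s : Finset ι} {y : Set (PbEvent f g)} {x : ι → Set (PbEvent f g)}
    (hy : PbUnion y) (hyfin : y.Finite) (hx : ∀ i ∈ s, PbUnion (y ∪ x i))
    (hxfin : ∀ i ∈ s, (x i).Finite) (hUW : ∀ i ∈ s, ∀ d ∈ x i, d ∉ y → d.img ∈ U ∪ W) :
    0 ≤ altSum s fun K => pbVal v w (y ∪ ⋃ i ∈ K, x i) := by
  classical
  induction hn : ∑ i ∈ s, (x i \ y).ncard using Nat.strong_induction_on generalizing y x with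
  | _ n ih =>
    by_cases hyc : PbStableConfig y
    swap
    · refine (altSum_eq_zero fun K _ => ?_).ge
      rw [pbVal, if_neg fun h => hyc (hy.stableConfig_of_subset h Set.subset_union_left)]
    by_cases hbig : ∃ i ∈ s, 1 < (x i \ y).ncard
    · obtain ⟨i, hi, hcard⟩ := hbig
      have hdiff : ∀ j ∈ s, (x j \ y).Finite := fun j hj => (hxfin j hj).subset Set.sdiff_subset
      obtain ⟨d, hd, hdy, hdu⟩ := hy.exists_insert (hx i hi) (by
        obtain ⟨b, hb⟩ := Set.nonempty_of_ncard_ne_zero (show (x i \ y).ncard ≠ 0 by omega)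
        exact ⟨b, Or.inr hb.1, hb.2⟩)
      have hdx : d ∈ x i := hd.resolve_left hdy
      rw [altSum_split (pbVal v w) hi y x (Set.singleton_subset_iff.2 hdx)]
      rw [← Set.union_singleton] at hdu
      refine add_nonneg (ih _ ?_ hy hyfin ?_ ?_ ?_ rfl)
        (ih _ ?_ hdu (hyfin.union (Set.finite_singleton d)) ?_ hxfin ?_ rfl)
      · rw [← hn]
        refine Finset.sum_lt_sum (fun j hj => ?_) ⟨i, hi, ?_⟩
        · by_cases hji : j = i
          · subst hji
            rw [Function.update_self]
            exact Set.ncard_le_ncard (Set.sdiff_subset_sdiff_left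
              (Set.singleton_subset_iff.2 hdx)) (hdiff j hj)
          · rw [Function.update_of_ne hji]
        · rw [Function.update_self]
          refine lt_of_le_of_lt ?_ hcard
          exact (Set.ncard_le_ncard Set.sdiff_subset (Set.finite_singleton d)).trans
            (Set.ncard_singleton d).le
      · intro j hj
        by_cases hji : j = i
        · subst hji
          rwa [Function.update_self]
        · rw [Function.update_of_ne hji]
          exact hx j hj
      · intro j hj
        by_cases hji : j = i
        · subst hji
          rw [Function.update_self]
          exact Set.finite_singleton d
        · rw [Function.update_of_ne hji]
          exact hxfin j hj
      · intro j hj e he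
        by_cases hji : j = i
        · subst hji
          rw [Function.update_self, Set.mem_singleton_iff] at he
          subst he
          exact hUW j hj e hdx
        · rw [Function.update_of_ne hji] at he
          exact hUW j hj e he
      · rw [← hn]
        refine Finset.sum_lt_sum (fun j hj => Set.ncard_le_ncard (Set.sdiff_subset_sdiff_right
          Set.subset_union_left) (hdiff j hj)) ⟨i, hi, ?_⟩
        refine Set.ncard_lt_ncard ⟨Set.sdiff_subset_sdiff_right Set.subset_union_left, fun h => ?_⟩
          (hdiff i hi)
        exact (h ⟨hdx, hdy⟩).2 (Or.inr rfl)
      · intro j hj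
        have := hdu.union (hx j hj)
        rwa [show y ∪ {d} ∪ (y ∪ x j) = y ∪ {d} ∪ x j by ext e; simp; tauto] at this
      · exact fun j hj e he hn => hUW j hj e he fun h => hn (Or.inl h)
    · refine pbVal_altSum_nonneg_of_forall hR hf hg hv hw hyc hyfin hx hxfin fun i hi => ?_
      have hle : (x i \ y).ncard ≤ 1 := not_lt.1 fun h => hbig ⟨i, hi, h⟩
      have hss := (Set.ncard_le_one ((hxfin i hi).subset Set.sdiff_subset)).1 hle
      by_contra! hcon
      obtain ⟨⟨d, hd, hdy, hdU⟩, d', hd', hdy', hdW⟩ := hcon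
      have := hss d ⟨hd, hdy⟩ d' ⟨hd', hdy'⟩
      subst this
      exact (hUW i hi d hd hdy).elim hdU hdW

end Pullback

/-! ### Immediate causality and valuations along inclusions -/

theorem EventStructure.imm_iff_of_embedding {E H : Type*} {P : EventStructure E}
    {P' : EventStructure H} {j : E → H} (hle : ∀ a b, P'.le (j a) (j b) ↔ P.le a b)
    (hr : ∀ b d e, P'.le (j b) d → P'.le d (j e) → d ∈ Set.range j) {a b : E} :
    P'.Imm (j a) (j b) ↔ P.Imm a b := by
  have hinj : Function.Injective j := fun a b h => P.le_antisymm
    ((hle _ _).1 (h ▸ P'.le_refl _)) ((hle _ _).1 (h ▸ P'.le_refl _))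
  constructor
  · rintro ⟨h₁, h₂, h₃⟩
    exact ⟨(hle _ _).1 h₁, fun h => h₂ (congrArg j h), fun d h h' =>
      (h₃ (j d) ((hle _ _).2 h) ((hle _ _).2 h')).imp (fun h => hinj h) fun h => hinj h⟩
  · rintro ⟨h₁, h₂, h₃⟩
    refine ⟨(hle _ _).2 h₁, fun h => h₂ (hinj h), fun d h h' => ?_⟩
    obtain ⟨c, rfl⟩ := hr _ _ _ h h'
    exact (h₃ c ((hle _ _).1 h) ((hle _ _).1 h')).imp (congrArg j) (congrArg j)

theorem EventStructure.extendZero_of_isFinConfig {E : Type*} {P : EventStructure E}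
    {v : Set E → ℝ} {x : Set E} (h : P.IsFinConfig x) : P.extendZero v x = v x := if_pos h

theorem EventStructure.extendZero_of_not {E : Type*} {P : EventStructure E}
    {v : Set E → ℝ} {x : Set E} (h : ¬ P.IsFinConfig x) : P.extendZero v x = 0 := if_neg h

theorem Polarity.eq_minus_iff {p : Polarity} : p = .minus ↔ p ≠ .plus := by cases p <;> simp

theorem EdcPol.IsConfigValuation.isExtendedValuation {E : Type*} {P : EdcPol E} {v : Set E → ℝ}
    (hv : P.IsConfigValuation v) :
    IsExtendedValuation P.toEventStructure {e | P.pol e = .plus} (P.extendZero v) where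
  eq_zero h := EventStructure.extendZero_of_not h
  lmc hx hy hxy h := by
    rw [EventStructure.extendZero_of_isFinConfig hx, EventStructure.extendZero_of_isFinConfig hy]
    exact hv.lmc _ _ hx hy ⟨hxy, fun e he hn => Polarity.eq_minus_iff.2 (h e he hn)⟩
  drop_nonneg hy hx hyx h := by
    rw [← EdcPol.drop_eq_altSum v hy hyx]
    exact hv.drop_nonneg _ _ _ hy hx fun i => ⟨hyx i, h i⟩

/-- A valuation on one component of a parallel composition, read as a valuation on the whole of it,
where all moves of the other component belong to Opponent. -/
theorem IsExtendedValuation.preimage {E H : Type*} {P : EventStructure E} {P' : EventStructure H}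
    {O : Set E} {v : Set E → ℝ} (hv : IsExtendedValuation P O v) {j : E → H}
    (hinj : Function.Injective j)
    (hj : ∀ x, P'.IsFinConfig x → P.IsFinConfig (j ⁻¹' x))
    (hj' : ∀ y z, P'.IsFinConfig y → y ⊆ z → z \ y ⊆ Set.range j → P.IsFinConfig (j ⁻¹' z) →
      P'.IsFinConfig z) :
    IsExtendedValuation P' (j '' O) (P'.extendZero fun x => v (j ⁻¹' x)) where
  eq_zero h := EventStructure.extendZero_of_not h
  lmc hx hy hxy h := by
    rw [EventStructure.extendZero_of_isFinConfig hx, EventStructure.extendZero_of_isFinConfig hy]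
    exact hv.lmc (hj _ hx) (hj _ hy) (Set.preimage_mono hxy) fun e he hn hO =>
      h (j e) he hn ⟨e, hO, rfl⟩
  drop_nonneg {y n x} hy hx hyx h := by
    have hinjO : ∀ i, ∀ e ∈ x i, e ∉ y → e ∈ Set.range j := fun i e he hn => by
      obtain ⟨a, -, rfl⟩ := h i e he hn
      exact ⟨a, rfl⟩
    rw [altSum_congr (ψ := fun K => v (j ⁻¹' y ∪ ⋃ i ∈ K, j ⁻¹' x i))]
    · refine hv.altSum_nonneg (hj _ hy) (fun i _ => ?_) fun i _ e he hn => ?_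
      · rw [Set.union_eq_right.2 (Set.preimage_mono (hyx i))]
        exact (hj _ (hx i)).1.2
      · obtain ⟨a, ha, hae⟩ := h i (j e) he hn
        rwa [← hinj hae]
    · intro K _
      rw [← Set.preimage_iUnion₂, ← Set.preimage_union]
      by_cases hc : P'.IsFinConfig (y ∪ ⋃ i ∈ K, x i)
      · rw [EventStructure.extendZero_of_isFinConfig hc]
      · rw [EventStructure.extendZero_of_not hc, hv.eq_zero]
        refine fun hn => hc (hj' y _ hy Set.subset_union_left ?_ hn)
        rintro e ⟨he | he, hn⟩
        · exact absurd he hn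
        · obtain ⟨i, -, he⟩ := Set.mem_iUnion₂.1 he
          exact hinjO i e he hn

/-! ### The arena of a composition -/

section Composition

variable {α β γ ς θ : Type*} {A : EdcPol α} {B : EdcPol β} {C : EdcPol γ}
  {S : EdcPol ς} {T : EdcPol θ}

/-- The moves of `A ∥ (B ∥ C)` over `A` and `C`. -/
def visibleMoves (α β γ : Type*) : Set (α ⊕ (β ⊕ γ)) := {u | (hideMiddle u).isSome}

/-- The moves of Player in `Aᗮ ∥ B`, as moves of `A ∥ (B ∥ C)`. -/
def leftMoves (A : EdcPol α) (B : EdcPol β) (γ : Type*) : Set (α ⊕ (β ⊕ γ)) :=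
  {u | Sum.elim (fun a => A.dual.pol a = .plus)
    (Sum.elim (fun b => B.pol b = .plus) fun _ => False) u}

/-- The moves of Player in `Bᗮ ∥ C`, as moves of `A ∥ (B ∥ C)`. -/
def rightMoves (α : Type*) (B : EdcPol β) (C : EdcPol γ) : Set (α ⊕ (β ⊕ γ)) :=
  {u | Sum.elim (fun _ => False)
    (Sum.elim (fun b => B.dual.pol b = .plus) fun c => C.pol c = .plus) u}

theorem Polarity.flip_eq_plus_iff {p : Polarity} : p.flip = .plus ↔ p = .minus := by
  cases p <;> simp [Polarity.flip]

theorem isArena_par (hA : A.IsGame) (hB : B.IsGame) (hC : C.IsGame) (rB : B.RaceFree) :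
    IsArena (A.toEdc.par (B.toEdc.par C.toEdc)) (visibleMoves α β γ) (leftMoves A B γ)
      (rightMoves α B C) where
  equiv_eq {a b} h := by
    rcases h with h | h | h
    · rw [hA _ _ h]
    · rw [hB _ _ h]
    · rw [hC _ _ h]
  disjoint {a} h h' := by
    rcases a with a | b | c
    · exact h'
    · have h₁ : B.pol b = .plus := h
      have h₂ : (B.pol b).flip = .plus := h'
      rw [h₁] at h₂
      cases h₂
    · exact h
  hidden {a} h := by
    rcases a with a | b | c
    · exact absurd rfl h
    · by_cases hb : B.pol b = .plus
      · exact Or.inl hb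
      · exact Or.inr (Polarity.flip_eq_plus_iff.2 (Polarity.eq_minus_iff.2 hb))
    · exact absurd rfl h
  mem_visible_iff h := by
    rcases h with h | h | h <;> exact Iff.rfl
  con {X} h h' := by
    refine ⟨A.con_mono ?_ h.1, B.con_mono ?_ h'.2.1, C.con_mono ?_ h.2.2⟩
    · exact fun a ha => ⟨ha, rfl⟩
    · exact fun b hb => ⟨hb, fun h => by cases h⟩
    · exact fun c hc => ⟨hc, rfl⟩
  union {y u w} hy hu hw hyu hyw hU hW := by
    rw [Edc.par_isFinConfig_iff, Edc.par_isFinConfig_iff] at hy hu hw ⊢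
    refine ⟨?_, ?_, ?_⟩
    · have : Sum.inl ⁻¹' (u ∪ w) = Sum.inl ⁻¹' u := by
        refine Set.union_eq_left.2 fun a ha => ?_
        by_contra hn
        exact hW ⟨ha, fun h => hn (hyu h)⟩
      rw [this]
      exact hu.1
    · refine rB.union hy.2.1 hu.2.1 hw.2.1 ⟨fun b hb => hyu hb, fun b hb hn => hU ⟨hb, hn⟩⟩
        ⟨fun b hb => hyw hb, fun b hb hn => Polarity.flip_eq_plus_iff.1 (hW ⟨hb, hn⟩)⟩
    · have : Sum.inr ⁻¹' (Sum.inr ⁻¹' (u ∪ w)) = Sum.inr ⁻¹' (Sum.inr ⁻¹' w) := by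
        refine Set.union_eq_right.2 fun c hc => ?_
        by_contra hn
        exact hU ⟨hc, fun h => hn (hyw h)⟩
      rw [this]
      exact hw.2.2

theorem Edc.imm_inl {E F : Type*} {P : Edc E} {Q : Edc F} {a b : E} :
    (P.par Q).Imm (.inl a) (.inl b) ↔ P.Imm a b :=
  EventStructure.imm_iff_of_embedding (j := Sum.inl) (fun _ _ => Sum.liftRel_inl_inl)
    fun _ d _ h _ => by cases h with | inl _ => exact ⟨_, rfl⟩

theorem Edc.imm_inr {E F : Type*} {P : Edc E} {Q : Edc F} {a b : F} :
    (P.par Q).Imm (.inr a) (.inr b) ↔ Q.Imm a b :=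
  EventStructure.imm_iff_of_embedding (j := Sum.inr) (fun _ _ => Sum.liftRel_inr_inr)
    fun _ d _ h _ => by cases h with | inr _ => exact ⟨_, rfl⟩

theorem Edc.imm_assoc {E F H : Type*} {P : Edc E} {Q : Edc F} {R : Edc H} {a b : E ⊕ F} :
    (P.par (Q.par R)).Imm (Equiv.sumAssoc E F H (.inl a)) (Equiv.sumAssoc E F H (.inl b)) ↔
      (P.par Q).Imm a b := by
  refine EventStructure.imm_iff_of_embedding (j := fun a => Equiv.sumAssoc E F H (.inl a))
    (fun a b => ?_) fun b d e h h' => ?_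
  · rcases a with a | a <;> rcases b with b | b <;> simp [Edc.par]
  · rcases b with b | b
    · cases h with | inl _ => exact ⟨.inl _, rfl⟩
    · cases h with | inr h => cases h with | inl _ => exact ⟨.inr _, rfl⟩

theorem imm_of_hideMiddle {P : Edc α} {Q : Edc β} {R : Edc γ} {u w : α ⊕ (β ⊕ γ)} {u' w' : α ⊕ γ}
    (hu : hideMiddle u = some u') (hw : hideMiddle w = some w')
    (h : (P.par (Q.par R)).Imm u w) : (P.par R).Imm u' w' := by
  rcases u with a | b | c <;> rcases w with a' | b' | c' <;>
    simp only [hideMiddle, Option.some.injEq, reduceCtorEq] at hu hw <;> subst hu hw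
  · exact Edc.imm_inl.2 (Edc.imm_inl.1 h)
  · cases h.1
  · cases h.1
  · exact Edc.imm_inr.2 (Edc.imm_inr.1 (Edc.imm_inr.1 h))

theorem strictBelow_inl {E F : Type*} {P : Edc E} {Q : Edc F} (e : E) :
    Sum.inl ⁻¹' (P.par Q).strictBelow (.inl e) = P.strictBelow e := by
  ext a
  simp [EventStructure.strictBelow, Edc.par]

theorem strictBelow_inr {E F : Type*} {P : Edc E} {Q : Edc F} (e : F) :
    Sum.inr ⁻¹' (P.par Q).strictBelow (.inr e) = Q.strictBelow e := by
  ext a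
  simp [EventStructure.strictBelow, Edc.par]

theorem leftMap_inl_mem_leftMoves (σ : PreStrategy S (A.dual.par B)) (s : ς) :
    (leftMap C σ).toFun (.inl s) ∈ leftMoves A B γ ↔ S.pol s = .plus := by
  rw [← σ.map_pol s]
  show Equiv.sumAssoc α β γ (.inl (σ.toFun s)) ∈ leftMoves A B γ ↔ _
  rcases σ.toFun s with a | b <;> exact Iff.rfl

theorem rightMap_inr_mem_rightMoves (τ : PreStrategy T (B.dual.par C)) (t : θ) :
    (rightMap A τ).toFun (.inr t) ∈ rightMoves α B C ↔ T.pol t = .plus := by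
  rw [← τ.map_pol t]
  show Sum.inr (τ.toFun t) ∈ rightMoves α B C ↔ _
  rcases τ.toFun t with b | c <;> exact Iff.rfl

theorem isComponent_leftMap {σ : PreStrategy S (A.dual.par B)} (hσ : σ.IsStrategy)
    (hC : C.IsGame) : IsComponent (leftMap C σ) (visibleMoves α β γ) (leftMoves A B γ)
      (rightMoves α B C) where
  innocent {e e'} h hU := by
    rcases e with s | c <;> rcases e' with s' | c'
    · refine Edc.imm_assoc.2 (hσ.innocent s s' (Edc.imm_inl.1 h) ?_)
      rw [leftMap_inl_mem_leftMoves, leftMap_inl_mem_leftMoves] at hU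
      rcases hU with hU | hU | hU
      · exact Or.inl hU
      · exfalso
        have hU : Equiv.sumAssoc α β γ (.inl (σ.toFun s)) ∈ visibleMoves α β γ ∩ rightMoves α B C :=
          hU
        generalize σ.toFun s = u at hU
        rcases u with a | b
        · exact hU.2
        · cases hU.1
      · exact Or.inr (Polarity.eq_minus_iff.2 hU)
    · cases h.1
    · cases h.1
    · exact Edc.imm_inr.2 (Edc.imm_inr.2 (Edc.imm_inr.1 h))
  plusConsistent {X} hX hd himg hplus := by
    have hd' : S.down (Sum.inl ⁻¹' X) = Sum.inl ⁻¹' X :=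
      EventStructure.down_eq_self fun s hs s' hle => hd _ hs _ (.inl hle)
    refine ⟨hσ.plusConsistent _ (hX.preimage Sum.inl_injective.injOn) ?_ ?_, ?_⟩
    · rw [hd']
      refine ⟨A.con_mono ?_ himg.1, B.con_mono ?_ himg.2.1⟩
      · rintro a ⟨s, hs, ha⟩
        exact ⟨.inl s, hs, congrArg (fun u => Equiv.sumAssoc α β γ (.inl u)) ha⟩
      · rintro b ⟨s, hs, hb⟩
        exact ⟨.inl s, hs, congrArg (fun u => Equiv.sumAssoc α β γ (.inl u)) hb⟩
    · rw [hd']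
      refine S.con_mono ?_ hplus.1
      exact fun s hs => ⟨hs.1, (leftMap_inl_mem_leftMoves σ s).2 hs.2⟩
    · refine C.con_mono ?_ himg.2.2
      exact fun c hc => ⟨.inr c, hc, rfl⟩
  nonRedundant {e e'} h heq hU := by
    cases heq with
    | @inl s s' heq =>
      rw [leftMap_inl_mem_leftMoves, ← ne_eq, ← Polarity.eq_minus_iff] at hU
      rw [hσ.nonRedundant s s' ?_ heq hU (S.pol_equiv heq ▸ hU)]
      rw [← strictBelow_inl (Q := C.toEdc), h, strictBelow_inl]
    | inr heq => rw [hC _ _ heq]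
  saturated {e e'} h := by
    have h' := (Equiv.sumAssoc α β γ).injective h
    rcases e with s | c <;> rcases e' with s' | c'
    · exact .inl (hσ.saturated s s' (Sum.inl_injective h'))
    · cases h'
    · cases h'
    · rw [show c = c' from Sum.inr_injective h']
      exact .inr (C.equiv_equivalence.refl _)

theorem isComponent_rightMap {τ : PreStrategy T (B.dual.par C)} (hτ : τ.IsStrategy)
    (hA : A.IsGame) : IsComponent (rightMap A τ) (visibleMoves α β γ) (rightMoves α B C)
      (leftMoves A B γ) where
  innocent {e e'} h hU := by
    rcases e with a | t <;> rcases e' with a' | t'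
    · exact Edc.imm_inl.2 (Edc.imm_inl.1 h)
    · cases h.1
    · cases h.1
    · refine Edc.imm_inr.2 (hτ.innocent t t' (Edc.imm_inr.1 h) ?_)
      rw [rightMap_inr_mem_rightMoves, rightMap_inr_mem_rightMoves] at hU
      rcases hU with hU | hU | hU
      · exact Or.inl hU
      · exfalso
        have hU : Sum.inr (τ.toFun t) ∈ visibleMoves α β γ ∩ leftMoves A B γ := hU
        generalize τ.toFun t = u at hU
        rcases u with b | c
        · cases hU.1
        · exact hU.2
      · exact Or.inr (Polarity.eq_minus_iff.2 hU)
  plusConsistent {X} hX hd himg hplus := by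
    have hd' : T.down (Sum.inr ⁻¹' X) = Sum.inr ⁻¹' X :=
      EventStructure.down_eq_self fun s hs s' hle => hd _ hs _ (.inr hle)
    refine ⟨?_, hτ.plusConsistent _ (hX.preimage Sum.inr_injective.injOn) ?_ ?_⟩
    · refine A.con_mono ?_ himg.1
      exact fun a ha => ⟨.inl a, ha, rfl⟩
    · rw [hd']
      refine ⟨B.con_mono ?_ himg.2.1, C.con_mono ?_ himg.2.2⟩
      · rintro b ⟨t, ht, hb⟩
        exact ⟨.inr t, ht, congrArg Sum.inr hb⟩
      · rintro c ⟨t, ht, hc⟩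
        exact ⟨.inr t, ht, congrArg Sum.inr hc⟩
    · rw [hd']
      refine T.con_mono ?_ hplus.2
      exact fun t ht => ⟨ht.1, (rightMap_inr_mem_rightMoves τ t).2 ht.2⟩
  nonRedundant {e e'} h heq hU := by
    cases heq with
    | inl heq => rw [hA _ _ heq]
    | @inr t t' heq =>
      rw [rightMap_inr_mem_rightMoves, ← ne_eq, ← Polarity.eq_minus_iff] at hU
      rw [hτ.nonRedundant t t' ?_ heq hU (T.pol_equiv heq ▸ hU)]
      rw [← strictBelow_inr (P := A.toEdc), h, strictBelow_inr]
  saturated {e e'} h := by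
    rcases e with a | t <;> rcases e' with a' | t'
    · rw [show a = a' from Sum.inl_injective h]
      exact .inl (A.equiv_equivalence.refl _)
    · cases h
    · cases h
    · exact .inr (hτ.saturated t t' (Sum.inr_injective h))

end Composition

section Composition

variable {α β γ ς θ : Type*} {A : EdcPol α} {B : EdcPol β} {C : EdcPol γ}
  {S : EdcPol ς} {T : EdcPol θ}

/-! ### The composition as a hidden pullback -/

theorem leftMoves_eq_image (σ : PreStrategy S (A.dual.par B)) :
    (leftMap C σ).toFun ⁻¹' leftMoves A B γ = Sum.inl '' {s | S.pol s = .plus} := by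
  ext (s | c)
  · simpa using leftMap_inl_mem_leftMoves σ s
  · exact ⟨fun h => h.elim, fun ⟨_, _, h⟩ => by cases h⟩

theorem rightMoves_eq_image (τ : PreStrategy T (B.dual.par C)) :
    (rightMap A τ).toFun ⁻¹' rightMoves α B C = Sum.inr '' {t | T.pol t = .plus} := by
  ext (a | t)
  · exact ⟨fun h => h.elim, fun ⟨_, _, h⟩ => by cases h⟩
  · simpa using rightMap_inr_mem_rightMoves τ t

/-- The valuation of `S`, as a function of sets of events of `S ∥ C`. -/
noncomputable def leftVal (S : EdcPol ς) (C : EdcPol γ) (v : Set ς → ℝ) : Set (ς ⊕ γ) → ℝ :=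
  (S.toEdc.par C.toEdc).extendZero fun x => S.extendZero v (Sum.inl ⁻¹' x)

/-- The valuation of `T`, as a function of sets of events of `A ∥ T`. -/
noncomputable def rightVal (A : EdcPol α) (T : EdcPol θ) (v : Set θ → ℝ) : Set (α ⊕ θ) → ℝ :=
  (A.toEdc.par T.toEdc).extendZero fun x => T.extendZero v (Sum.inr ⁻¹' x)

theorem isExtendedValuation_leftVal (σ : PreStrategy S (A.dual.par B)) {v : Set ς → ℝ}
    (hv : S.IsConfigValuation v) :
    IsExtendedValuation (S.toEdc.par C.toEdc).toEventStructure
      ((leftMap C σ).toFun ⁻¹' leftMoves A B γ) (leftVal S C v) := by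
  rw [leftMoves_eq_image]
  refine hv.isExtendedValuation.preimage Sum.inl_injective
    (fun x hx => (Edc.par_isFinConfig_iff.1 hx).1) fun y z hy hyz hr hz => ?_
  refine Edc.par_isFinConfig_iff.2 ⟨hz, ?_⟩
  rw [show Sum.inr ⁻¹' z = Sum.inr ⁻¹' y from ?_]
  · exact (Edc.par_isFinConfig_iff.1 hy).2
  · refine Set.Subset.antisymm (fun c hc => ?_) (Set.preimage_mono hyz)
    by_contra hn
    obtain ⟨s, hs⟩ := hr ⟨hc, hn⟩
    cases hs

theorem isExtendedValuation_rightVal (τ : PreStrategy T (B.dual.par C)) {v : Set θ → ℝ}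
    (hv : T.IsConfigValuation v) :
    IsExtendedValuation (A.toEdc.par T.toEdc).toEventStructure
      ((rightMap A τ).toFun ⁻¹' rightMoves α B C) (rightVal A T v) := by
  rw [rightMoves_eq_image]
  refine hv.isExtendedValuation.preimage Sum.inr_injective
    (fun x hx => (Edc.par_isFinConfig_iff.1 hx).2) fun y z hy hyz hr hz => ?_
  refine Edc.par_isFinConfig_iff.2 ⟨?_, hz⟩
  rw [show Sum.inl ⁻¹' z = Sum.inl ⁻¹' y from ?_]
  · exact (Edc.par_isFinConfig_iff.1 hy).1
  · refine Set.Subset.antisymm (fun c hc => ?_) (Set.preimage_mono hyz)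
    by_contra hn
    obtain ⟨s, hs⟩ := hr ⟨hc, hn⟩
    cases hs

variable (σ : PreStrategy S (A.dual.par B)) (τ : PreStrategy T (B.dual.par C))

/-- The events of the pullback which occur in a set of events of the composition. -/
def compEvents (x : Set (visible σ τ)) : Set (PbEvent (leftMap C σ) (rightMap A τ)) :=
  eventsOf (V := visibleMoves α β γ) x

theorem compEvents_union_biUnion {ι : Type*} (y : Set (visible σ τ)) (K : Finset ι)
    (x : ι → Set (visible σ τ)) : compEvents σ τ (y ∪ ⋃ i ∈ K, x i) =
      compEvents σ τ y ∪ ⋃ i ∈ K, compEvents σ τ (x i) := by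
  have h : ∀ (z : Set (visible σ τ)) d, d ∈ compEvents σ τ z ↔ ∃ p ∈ z, d ∈ p.1.carrier :=
    fun z d => Set.mem_iUnion₂.trans
      ⟨fun ⟨p, hp, h⟩ => ⟨p, hp, h⟩, fun ⟨p, hp, h⟩ => ⟨p, hp, h⟩⟩
  ext d
  simp only [h, Set.mem_union, Set.mem_iUnion, exists_prop]
  constructor
  · rintro ⟨p, hp | ⟨i, hi, hp⟩, hd⟩
    · exact Or.inl ⟨p, hp, hd⟩
    · exact Or.inr ⟨i, hi, p, hp, hd⟩
  · rintro (⟨p, hp, hd⟩ | ⟨i, hi, p, hp, hd⟩)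
    · exact ⟨p, Or.inl hp, hd⟩
    · exact ⟨p, Or.inr ⟨i, hi, hp⟩, hd⟩

theorem compEdc_isFinConfig_iff {x : Set (visible σ τ)} (hx : x.Finite)
    (hd : ∀ p ∈ x, ∀ q, (compEdc σ τ).le q p → q ∈ x) :
    (compEdc σ τ).IsFinConfig x ↔ PbStableConfig (compEvents σ τ x) := by
  have h := mem_hiddenPullback_con (f := leftMap C σ) (g := rightMap A τ)
    (V := visibleMoves α β γ) (x := x)
  exact ⟨fun h' => (h.1 h'.mem_con).2,
    fun h' => EventStructure.isFinConfig_of_mem_con (h.2 ⟨hx, h'⟩) hd⟩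

theorem projS_eq (x : Set (visible σ τ)) :
    projS σ τ x = Sum.inl ⁻¹' (PbEvent.fst '' compEvents σ τ x) := by
  ext e
  constructor
  · rintro ⟨q, ⟨_, ⟨p, hp, rfl⟩, hqp⟩, he⟩
    exact ⟨q.top, Set.mem_biUnion hp (hqp q.top_mem), he⟩
  · rintro ⟨d, hd, he⟩
    obtain ⟨p, hp, hd⟩ := Set.mem_iUnion₂.1 hd
    obtain ⟨q, hq, rfl⟩ := p.1.exists_sub hd
    exact ⟨q, ⟨p.1, ⟨p, hp, rfl⟩, hq⟩, he⟩

theorem projT_eq (x : Set (visible σ τ)) :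
    projT σ τ x = Sum.inr ⁻¹' (PbEvent.snd '' compEvents σ τ x) := by
  ext e
  constructor
  · rintro ⟨q, ⟨_, ⟨p, hp, rfl⟩, hqp⟩, he⟩
    exact ⟨q.top, Set.mem_biUnion hp (hqp q.top_mem), he⟩
  · rintro ⟨d, hd, he⟩
    obtain ⟨p, hp, hd⟩ := Set.mem_iUnion₂.1 hd
    obtain ⟨q, hq, rfl⟩ := p.1.exists_sub hd
    exact ⟨q, ⟨p.1, ⟨p, hp, rfl⟩, hq⟩, he⟩

theorem projS_isFinConfig {x : Set (visible σ τ)} (hx : (compEdc σ τ).IsFinConfig x) :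
    S.IsFinConfig (projS σ τ x) := by
  rw [projS_eq]
  exact (Edc.par_isFinConfig_iff.1 (((compEdc_isFinConfig_iff σ τ hx.2 hx.1.2).1 hx).fst_isFinConfig
    (eventsOf_finite hx.2))).1

theorem projT_isFinConfig {x : Set (visible σ τ)} (hx : (compEdc σ τ).IsFinConfig x) :
    T.IsFinConfig (projT σ τ x) := by
  rw [projT_eq]
  exact (Edc.par_isFinConfig_iff.1 (((compEdc_isFinConfig_iff σ τ hx.2 hx.1.2).1 hx).snd_isFinConfig
    (eventsOf_finite hx.2))).2

theorem compVal_eq {vS : Set ς → ℝ} {vT : Set θ → ℝ} {x : Set (visible σ τ)}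
    (hx : (compEdc σ τ).IsFinConfig x) :
    compVal σ τ vS vT x = leftVal S C vS (PbEvent.fst '' compEvents σ τ x) *
      rightVal A T vT (PbEvent.snd '' compEvents σ τ x) := by
  have hs := (compEdc_isFinConfig_iff σ τ hx.2 hx.1.2).1 hx
  have hf : (compEvents σ τ x).Finite := eventsOf_finite hx.2
  rw [leftVal, rightVal, EventStructure.extendZero_of_isFinConfig (hs.fst_isFinConfig hf),
    EventStructure.extendZero_of_isFinConfig (hs.snd_isFinConfig hf), ← projS_eq, ← projT_eq,
    EventStructure.extendZero_of_isFinConfig (projS_isFinConfig σ τ hx),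
    EventStructure.extendZero_of_isFinConfig (projT_isFinConfig σ τ hx), compVal]

theorem extendZero_compVal {vS : Set ς → ℝ} {vT : Set θ → ℝ} {x : Set (visible σ τ)}
    (hx : x.Finite) (hd : ∀ p ∈ x, ∀ q, (compEdc σ τ).le q p → q ∈ x) :
    (compEdc σ τ).extendZero (compVal σ τ vS vT) x =
      pbVal (leftVal S C vS) (rightVal A T vT) (compEvents σ τ x) := by
  by_cases hc : (compEdc σ τ).IsFinConfig x
  · rw [EventStructure.extendZero_of_isFinConfig hc, compVal_eq σ τ hc, pbVal,
      if_pos ((compEdc_isFinConfig_iff σ τ hx hd).1 hc)]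
  · rw [EventStructure.extendZero_of_not hc, pbVal,
      if_neg fun h => hc ((compEdc_isFinConfig_iff σ τ hx hd).2 h)]

theorem pol_eq_plus_iff {u : α ⊕ (β ⊕ γ)} {u' : α ⊕ γ} (hu : hideMiddle u = some u') :
    (A.dual.par C).pol u' = .plus ↔ u ∈ leftMoves A B γ ∪ rightMoves α B C := by
  rcases u with a | b | c <;> simp only [hideMiddle, Option.some.injEq, reduceCtorEq] at hu <;>
    subst hu
  · exact (iff_of_eq (or_false _)).symm
  · exact (iff_of_eq (false_or _)).symm

theorem compEdc_pol_eq_plus_iff (p : visible σ τ) :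
    (compEdc σ τ).pol p = .plus ↔ p.1.top.img ∈ leftMoves A B γ ∪ rightMoves α B C :=
  pol_eq_plus_iff (compFun_eq σ τ p)

variable {σ τ}

theorem comp_innocent (hR : IsArena (A.toEdc.par (B.toEdc.par C.toEdc)) (visibleMoves α β γ)
      (leftMoves A B γ) (rightMoves α B C))
    (hf : IsComponent (leftMap C σ) (visibleMoves α β γ) (leftMoves A B γ) (rightMoves α B C))
    (hg : IsComponent (rightMap A τ) (visibleMoves α β γ) (rightMoves α B C) (leftMoves A B γ)) :
    (comp σ τ).Innocent := by
  intro p p' h hp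
  refine imm_of_hideMiddle (compFun_eq σ τ p) (compFun_eq σ τ p')
    (hiddenPullback_innocent hR hf hg (p := p) (p' := p') h ?_)
  rw [← compEdc_pol_eq_plus_iff σ τ p, ← compEdc_pol_eq_plus_iff σ τ p', ← ne_eq,
    ← Polarity.eq_minus_iff]
  exact hp

theorem comp_plusConsistent (hR : IsArena (A.toEdc.par (B.toEdc.par C.toEdc)) (visibleMoves α β γ)
      (leftMoves A B γ) (rightMoves α B C))
    (hf : IsComponent (leftMap C σ) (visibleMoves α β γ) (leftMoves A B γ) (rightMoves α B C))
    (hg : IsComponent (rightMap A τ) (visibleMoves α β γ) (rightMoves α B C) (leftMoves A B γ)) :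
    (comp σ τ).PlusConsistent := by
  intro X hX himg hplus
  refine hiddenPullback_plusConsistent hR hf hg (X := X) hX ⟨A.con_mono ?_ himg.1,
    B.con_mono ?_ B.con_empty, C.con_mono ?_ himg.2⟩ ?_
  · rintro a ⟨p, hp, ha⟩
    refine ⟨p, hp, Option.some_injective _ ((compFun_eq σ τ p).symm.trans ?_)⟩
    exact congrArg hideMiddle ha
  · rintro b ⟨p, hp, hb⟩
    have := (compFun_eq σ τ p).symm.trans (congrArg hideMiddle hb)
    cases this
  · rintro c ⟨p, hp, hc⟩
    refine ⟨p, hp, Option.some_injective _ ((compFun_eq σ τ p).symm.trans ?_)⟩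
    exact congrArg hideMiddle hc
  · refine (compEdc σ τ).con_mono ?_ hplus
    rintro p ⟨hp, hpU⟩
    exact ⟨hp, (compEdc_pol_eq_plus_iff σ τ p).2 hpU⟩

theorem compEdc_nonRedundant
    (hR : IsArena (A.toEdc.par (B.toEdc.par C.toEdc)) (visibleMoves α β γ)
      (leftMoves A B γ) (rightMoves α B C))
    (hf : IsComponent (leftMap C σ) (visibleMoves α β γ) (leftMoves A B γ) (rightMoves α B C))
    (hg : IsComponent (rightMap A τ) (visibleMoves α β γ) (rightMoves α B C) (leftMoves A B γ)) :
    (compEdc σ τ).NonRedundant := by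
  intro p p' h heq hp _
  refine hiddenPullback_nonRedundant hR hf hg (p := p) (p' := p') h
    ((pbEquiv_iff hR hf hg).1 heq) ?_
  rw [← compEdc_pol_eq_plus_iff σ τ p, ← ne_eq, ← Polarity.eq_minus_iff]
  exact hp

theorem comp_saturated (hR : IsArena (A.toEdc.par (B.toEdc.par C.toEdc)) (visibleMoves α β γ)
      (leftMoves A B γ) (rightMoves α B C))
    (hf : IsComponent (leftMap C σ) (visibleMoves α β γ) (leftMoves A B γ) (rightMoves α B C))
    (hg : IsComponent (rightMap A τ) (visibleMoves α β γ) (rightMoves α B C) (leftMoves A B γ)) :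
    (comp σ τ).Saturated := by
  intro p p' h
  refine (pbEquiv_iff hR hf hg).2 (hR.equiv_eq ?_)
  refine (hideMiddle_equiv_iff (compFun_eq σ τ p) (compFun_eq σ τ p')).2 ?_
  rw [show compFun σ τ p = compFun σ τ p' from h]
  exact (A.toEdc.par C.toEdc).equiv_equivalence.refl _

/-- An extension by Opponent moves of the composition extends both projections by Opponent moves
only: by `mem_eventsOf_of_mem`, no hidden event is needed to enable them. -/
theorem compVal_lmc (hR : IsArena (A.toEdc.par (B.toEdc.par C.toEdc)) (visibleMoves α β γ)
      (leftMoves A B γ) (rightMoves α B C))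
    (hf : IsComponent (leftMap C σ) (visibleMoves α β γ) (leftMoves A B γ) (rightMoves α B C))
    (hg : IsComponent (rightMap A τ) (visibleMoves α β γ) (rightMoves α B C) (leftMoves A B γ))
    {vS : Set ς → ℝ} {vT : Set θ → ℝ} (hvS : S.IsConfigValuation vS) (hvT : T.IsConfigValuation vT)
    {x y : Set (visible σ τ)} (hx : (compEdc σ τ).IsFinConfig x) (hy : (compEdc σ τ).IsFinConfig y)
    (hxy : (compEdc σ τ).SubMinus x y) : compVal σ τ vS vT x = compVal σ τ vS vT y := by
  have hsub : compEvents σ τ x ⊆ compEvents σ τ y := Set.biUnion_subset_biUnion_left hxy.1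
  have hxs := (compEdc_isFinConfig_iff σ τ hx.2 hx.1.2).1 hx
  have hys := (compEdc_isFinConfig_iff σ τ hy.2 hy.1.2).1 hy
  have hxf : (compEvents σ τ x).Finite := eventsOf_finite hx.2
  have hyf : (compEvents σ τ y).Finite := eventsOf_finite hy.2
  have key : ∀ d ∈ compEvents σ τ y, d.img ∈ leftMoves A B γ ∪ rightMoves α B C →
      d ∈ compEvents σ τ x := fun d hd hdU =>
    mem_eventsOf_of_mem hR hf hg (x := y) (y := x) (by
      rintro p ⟨q, hq, hpq⟩ hpU
      by_contra hn
      have := hxy.2 p (hy.1.2 q hq p hpq) hn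
      exact Polarity.eq_minus_iff.1 this ((compEdc_pol_eq_plus_iff σ τ p).2 hpU)) hd hdU
  rw [compVal_eq σ τ hx, compVal_eq σ τ hy]
  congr 1
  · refine (isExtendedValuation_leftVal σ hvS).lmc (hxs.fst_isFinConfig hxf)
      (hys.fst_isFinConfig hyf) (Set.image_mono hsub) ?_
    rintro _ ⟨d, hd, rfl⟩ hn hdU
    exact hn ⟨d, key d hd (Or.inl hdU), rfl⟩
  · refine (isExtendedValuation_rightVal τ hvT).lmc (hxs.snd_isFinConfig hxf)
      (hys.snd_isFinConfig hyf) (Set.image_mono hsub) ?_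
    rintro _ ⟨d, hd, rfl⟩ hn hdU
    exact hn ⟨d, key d hd (Or.inr (d.img_eq ▸ hdU)), rfl⟩

theorem compVal_drop_nonneg
    (hR : IsArena (A.toEdc.par (B.toEdc.par C.toEdc)) (visibleMoves α β γ)
      (leftMoves A B γ) (rightMoves α B C))
    (hf : IsComponent (leftMap C σ) (visibleMoves α β γ) (leftMoves A B γ) (rightMoves α B C))
    (hg : IsComponent (rightMap A τ) (visibleMoves α β γ) (rightMoves α B C) (leftMoves A B γ))
    {vS : Set ς → ℝ} {vT : Set θ → ℝ} (hvS : S.IsConfigValuation vS) (hvT : T.IsConfigValuation vT)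
    {y : Set (visible σ τ)} {n : ℕ} {x : Fin n → Set (visible σ τ)}
    (hy : (compEdc σ τ).IsFinConfig y) (hx : ∀ i, (compEdc σ τ).IsFinConfig (x i))
    (hyx : ∀ i, (compEdc σ τ).SubPlus y (x i)) :
    0 ≤ (compEdc σ τ).drop (compVal σ τ vS vT) y x := by
  rw [EdcPol.drop_eq_altSum _ hy fun i => (hyx i).1]
  have h := pbVal_altSum_nonneg hR hf hg (isExtendedValuation_leftVal σ hvS)
    (isExtendedValuation_rightVal τ hvT) (s := Finset.univ) (y := compEvents σ τ y)
    (x := fun i => compEvents σ τ (x i)) (eventsOf_pbUnion _) (eventsOf_finite hy.2)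
    (fun i _ => (eventsOf_pbUnion _).union (eventsOf_pbUnion _))
    (fun i _ => eventsOf_finite (hx i).2) ?_
  · rw [altSum_congr fun K _ => ?_]
    · exact h
    · show _ = pbVal _ _ _
      rw [extendZero_compVal]
      · rw [compEvents_union_biUnion]
      · exact hy.2.union (K.finite_toSet.biUnion fun i _ => (hx i).2)
      · rintro p (hp | hp) q hqp
        · exact Or.inl (hy.1.2 p hp q hqp)
        · obtain ⟨i, hi, hp⟩ := Set.mem_iUnion₂.1 hp
          exact Or.inr (Set.mem_biUnion (t := x) (show i ∈ (K : Set (Fin n)) from hi)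
            ((hx i).1.2 p hp q hqp))
  · -- A move of the environment in `x i` is visible, so it occurs in `y`.
    intro i _ d hd hdy
    by_contra hn
    obtain ⟨p, hp, hd⟩ := Set.mem_iUnion₂.1 hd
    obtain ⟨q, hq, rfl⟩ := p.1.exists_sub hd
    have hqV : q.top.img ∈ visibleMoves α β γ := by
      by_contra hV
      exact hn (hR.hidden hV)
    have hqx : (⟨q, hqV⟩ : visible σ τ) ∈ x i := (hx i).1.2 p hp _ hq
    by_cases hqy : (⟨q, hqV⟩ : visible σ τ) ∈ y
    · exact hdy (Set.mem_biUnion (t := fun p : visible σ τ => p.1.carrier) hqy q.top_mem)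
    · exact hn ((compEdc_pol_eq_plus_iff σ τ _).1 ((hyx i).2 _ hqx hqy))

theorem compEvents_empty : compEvents σ τ ∅ = ∅ := Set.biUnion_empty _

theorem projS_empty : projS σ τ ∅ = ∅ := by
  rw [projS_eq, compEvents_empty, Set.image_empty, Set.preimage_empty]

theorem projT_empty : projT σ τ ∅ = ∅ := by
  rw [projT_eq, compEvents_empty, Set.image_empty, Set.preimage_empty]

end Composition

theorem mainTheorem6 {α β γ ς θ : Type*}
    (A : EdcPol α) (B : EdcPol β) (C : EdcPol γ)
    (hA : A.IsGame) (hB : B.IsGame) (hC : C.IsGame)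
    (rA : A.RaceFree) (rB : B.RaceFree) (rC : C.RaceFree)
    (S : EdcPol ς) (T : EdcPol θ)
    (σ : PreStrategy S (A.dual.par B)) (τ : PreStrategy T (B.dual.par C))
    (vS : Set ς → ℝ) (vT : Set θ → ℝ)
    (hσ : σ.IsProbStrategy vS) (hτ : τ.IsProbStrategy vT) :
    (compEdc σ τ).IsConfigValuation (compVal σ τ vS vT) ∧
    (comp σ τ).Innocent ∧ (comp σ τ).PlusConsistent ∧
    (compEdc σ τ).NonRedundant ∧ (comp σ τ).Saturated := by
  have hR := isArena_par hA hB hC rB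
  have hf := isComponent_leftMap (C := C) hσ.isStrategy hC
  have hg := isComponent_rightMap (A := A) hτ.isStrategy hA
  have hS := hσ.isConfigValuation
  have hT := hτ.isConfigValuation
  refine ⟨⟨fun x hx => ?_, ?_, fun x y hx hy => compVal_lmc hR hf hg hS hT hx hy,
    fun y n x hy hx => compVal_drop_nonneg hR hf hg hS hT hy hx⟩, comp_innocent hR hf hg,
    comp_plusConsistent hR hf hg, compEdc_nonRedundant hR hf hg, comp_saturated hR hf hg⟩
  · have h₁ := hS.mem_unit _ (projS_isFinConfig σ τ hx)
    have h₂ := hT.mem_unit _ (projT_isFinConfig σ τ hx)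
    exact ⟨mul_nonneg h₁.1 h₂.1, mul_le_one₀ h₁.2 h₂.1 h₂.2⟩
  · rw [compVal, projS_empty, projT_empty, hS.normalized, hT.normalized, mul_one]
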